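/- **Universal property of relative blow-ups.** A *pair of schemes* $(Y\xrightarrow{f}X)$, written $(Y,X)$, consists of quasi-compact quasi-separated schemes $Y,X$ and an affine, schematically dominant morphism $f:Y\to X$. A *morphism of pairs* $h=(h_Y,h_X):(Y'\xrightarrow{f'}X')\to(Y\xrightarrow{f}X)$ consists of morphisms $h_Y:Y'\to Y$ and $h_X:X'\to X$ with $f\circ h_Y=h_X\circ f'$. Let $(Y\xrightarrow{f}X)$ be a pair of schemes and let $\mathcal E\subset f_*\mathcal O_Y$ be a quasi-coherent $\mathcal O_X$-submodule of finite type that contains $f^\sharp(\mathcal O_X)$. For $d\ge 1$ let $\mathcal E^d\subset f_*\mathcal O_Y$ be the image of $\mathcal E^{\otimes d}$ under the multiplication of $f_*\mathcal O_Y$, let $\mathcal E^0=\mathcal O_X$, and put $$X_{\mathcal E}=\mathbf{Proj}_X\Big(\bigoplus_{d\ge0}\mathcal E^d\Big),\qquad \pi_{\mathcal E}:X_{\mathcal E}\to X .$$ Let $s$ be the section $1\in\mathcal E$ placed in degree $1$, and let $f_{\mathcal E}:Y\to X_{\mathcal E}$ be the $X$-morphism that is the composition of the open immersion $(X_{\mathcal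 E})_s\to X_{\mathcal E}$ with the morphism $Y\simeq\mathbf{Spec}_X(f_*\mathcal O_Y)\to (X_{\mathcal E})_s=\mathbf{Spec}_X\big((\bigoplus_d\mathcal E^d)_{(s)}\big)$ given by $e/s^d\mapsto e$ for $e\in\mathcal E^d$. Then $(Y\xrightarrow{f_{\mathcal E}}X_{\mathcal E})$ is a pair of schemes, and $g_{\mathcal E}=(\mathrm{id}_Y,\pi_{\mathcal E}):(Y,X_{\mathcal E})\to(Y,X)$ is a morphism of pairs, called the *relative blow-up* of $(Y,X)$ with respect to $\mathcal E$. Let $h=(h_Y,h_X):(Y'\xrightarrow{f'}X')\to(Y\xrightarrow{f}X)$ be a morphism of pairs, and let the *inverse image module* $h^{-1}(\mathcal E)\subset f'_*\mathcal O_{Y'}$ be the image of the composition $$h_X^*\mathcal E\to h_X^*f_*\mathcal O_Y\to h_X^*(f\circ h_Y)_*\mathcal O_{Y'}=h_X^*(h_X\circ f')_*\mathcal O_{Y'}\to f'_*\mathcal O_{Y'} .$$ If $h^{-1}(\mathcal E)$ is an invertible $\mathcal O_{X'}$-module, then $h$ factors uniquely through $g_{\mathcal E}$: there is exactly one morphism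 of pairs $h':(Y',X')\to(Y,X_{\mathcal E})$ with $g_{\mathcal E}\circ h'=h$. -/

import Mathlib

open CategoryTheory Limits AlgebraicGeometry Opposite TopologicalSpace

universe u

namespace RelBlowUp

section Algebra

open Polynomial

variable {A B : Type u} [CommRing A] [CommRing B] [Algebra A B]

/-- The graded algebra `⨁ d, E ^ d`, realised inside `B[T]` as the polynomials with coefficient of
`T ^ d` in `E ^ d`. The product `E ^ d ⊆ B` is the image of `E ^ ⊗ d`, and `E ^ 0` is the image of
`A` in `B`. -/
def rees (E : Submodule A B) : Subalgebra A B[X] where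
  carrier := { p | ∀ d, p.coeff d ∈ E ^ d }
  mul_mem' {p q} hp hq d := by
    rw [coeff_mul]
    refine Submodule.sum_mem _ ?_
    rintro ⟨i, j⟩ h
    rw [← Finset.HasAntidiagonal.mem_antidiagonal.mp h, pow_add]
    exact Submodule.mul_mem_mul (hp i) (hq j)
  add_mem' {p q} hp hq d := by
    rw [coeff_add]
    exact Submodule.add_mem _ (hp d) (hq d)
  algebraMap_mem' a d := by
    rw [Polynomial.algebraMap_apply, coeff_C]
    split_ifs with h
    · subst h
      rw [pow_zero, Submodule.mem_one]
      exact ⟨a, rfl⟩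
    · exact Submodule.zero_mem _

/-- The homogeneous elements of degree `d` of `⨁ d, E ^ d`. -/
def reesGrading (E : Submodule A B) (d : ℕ) : Submodule A (rees E) where
  carrier := { p | ∀ i, i ≠ d → (p : B[X]).coeff i = 0 }
  add_mem' {p q} hp hq i hi := by
    rw [Subalgebra.coe_add, coeff_add, hp i hi, hq i hi, add_zero]
  zero_mem' i _ := by simp
  smul_mem' a p hp i hi := by
    rw [Subalgebra.coe_smul, coeff_smul, hp i hi, smul_zero]

lemma mem_reesGrading {E : Submodule A B} {d : ℕ} {p : rees E} :
    p ∈ reesGrading E d ↔ ∀ i, i ≠ d → (p : B[X]).coeff i = 0 := Iff.rfl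

/-- The element `b T ^ d`, for `b ∈ E ^ d`. -/
noncomputable def reesMonomial (E : Submodule A B) (d : ℕ) (b : B) (hb : b ∈ E ^ d) : rees E :=
  ⟨monomial d b, fun i ↦ by
    rw [coeff_monomial]
    split_ifs with h
    · exact h ▸ hb
    · exact Submodule.zero_mem _⟩

lemma reesMonomial_mem (E : Submodule A B) (d : ℕ) (b : B) (hb : b ∈ E ^ d) :
    reesMonomial E d b hb ∈ reesGrading E d := fun i hi ↦ by
  simp [reesMonomial, coeff_monomial, Ne.symm hi]

lemma eq_reesMonomial {E : Submodule A B} {d : ℕ} {p : rees E} (hp : p ∈ reesGrading E d) :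
    p = reesMonomial E d ((p : B[X]).coeff d) (p.2 d) := by
  ext i
  simp only [reesMonomial, coeff_monomial]
  split_ifs with h
  · rw [h]
  · exact hp i (Ne.symm h)

lemma rees_isInternal (E : Submodule A B) : DirectSum.IsInternal (reesGrading E) := by
  classical
  have hcoeff (x : DirectSum ℕ fun d ↦ reesGrading E d) (d : ℕ) :
      ((DirectSum.coeAddMonoidHom (reesGrading E) x : rees E) : B[X]).coeff d =
        ((x d : rees E) : B[X]).coeff d := by
    induction x using DirectSum.induction_on with
    | zero => simp
    | of i x =>
      rw [DirectSum.coeAddMonoidHom_of]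
      by_cases h : i = d
      · subst h; rw [DirectSum.of_eq_same]
      · rw [DirectSum.of_eq_of_ne _ _ _ (Ne.symm h), x.2 d (Ne.symm h)]; simp
    | add x y hx hy => simp [hx, hy]
  constructor
  · intro x y hxy
    ext d i
    by_cases h : i = d
    · subst h; rw [← hcoeff, ← hcoeff, hxy]
    · rw [(x d).2 i h, (y d).2 i h]
  · intro p
    refine ⟨∑ i ∈ (p : B[X]).support, DirectSum.of (fun d ↦ reesGrading E d) i
      ⟨reesMonomial E i _ (p.2 i), reesMonomial_mem E i _ (p.2 i)⟩, ?_⟩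
    rw [map_sum]
    simp only [DirectSum.coeAddMonoidHom_of]
    apply Subtype.ext
    rw [AddSubmonoidClass.coe_finsetSum]
    exact ((p : B[X]).as_sum_support).symm

noncomputable instance (E : Submodule A B) : GradedAlgebra (reesGrading E) where
  one_mem i hi := by
    rw [OneMemClass.coe_one, coeff_one, if_neg hi]
  mul_mem i j p q hp hq n hn := by
    rw [MulMemClass.coe_mul, coeff_mul]
    refine Finset.sum_eq_zero ?_
    rintro ⟨k, l⟩ h
    have := Finset.HasAntidiagonal.mem_antidiagonal.mp h
    by_cases hk : k = i
    · rw [hq l (by rintro rfl; exact hn (by simp_all)), mul_zero]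
    · rw [hp k hk, zero_mul]
  toDecomposition := (rees_isInternal E).chooseDecomposition

variable {A' B' : Type u} [CommRing A'] [CommRing B'] [Algebra A' B']

lemma map_mem_pow {E : Submodule A B} {E' : Submodule A' B'} (σ : A →+* A') (ψ : B →+* B')
    (h : ∀ a, ψ (algebraMap A B a) = algebraMap A' B' (σ a)) (hE : ∀ b ∈ E, ψ b ∈ E')
    (d : ℕ) (b : B) (hb : b ∈ E ^ d) : ψ b ∈ E' ^ d := by
  induction d generalizing b with
  | zero =>
    rw [pow_zero, Submodule.mem_one] at hb ⊢
    obtain ⟨a, rfl⟩ := hb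
    exact ⟨σ a, (h a).symm⟩
  | succ d ih =>
    rw [pow_succ] at hb ⊢
    induction hb using Submodule.mul_induction_on' with
    | mem_mul_mem x hx y hy =>
      rw [map_mul]; exact Submodule.mul_mem_mul (ih x hx) (hE y hy)
    | add x _ y _ hx hy => rw [map_add]; exact Submodule.add_mem _ hx hy

open Graded in
/-- A map of pairs of rings carrying `E` into `E'` induces a graded map of the algebras
`⨁ d, E ^ d`. -/
noncomputable def reesMap (E : Submodule A B) (E' : Submodule A' B') (σ : A →+* A') (ψ : B →+* B')
    (h : ∀ a, ψ (algebraMap A B a) = algebraMap A' B' (σ a)) (hE : ∀ b ∈ E, ψ b ∈ E') :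
    reesGrading E →+*ᵍ reesGrading E' where
  toRingHom := ((mapRingHom ψ).comp (rees E).val.toRingHom).codRestrict (rees E') fun p d ↦ by
    change (Polynomial.map ψ (p : B[X])).coeff d ∈ _
    rw [coeff_map]
    exact map_mem_pow σ ψ h hE d _ (p.2 d)
  map_mem {d p} hp i hi := by
    change (Polynomial.map ψ (p : B[X])).coeff i = 0
    rw [coeff_map, hp i hi, map_zero]

lemma coe_reesMap {E : Submodule A B} {E' : Submodule A' B'} {σ : A →+* A'} {ψ : B →+* B'}
    (h : ∀ a, ψ (algebraMap A B a) = algebraMap A' B' (σ a)) (hE : ∀ b ∈ E, ψ b ∈ E')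
    (p : rees E) : (reesMap E E' σ ψ h hE p : B'[X]) = Polynomial.map ψ p := rfl

/-- The sum map `⨁ d, E ^ d → B`. -/
noncomputable def reesEval (E : Submodule A B) : rees E →+* B :=
  (evalRingHom 1).comp (rees E).val.toRingHom

lemma reesEval_reesMap {E : Submodule A B} {E' : Submodule A' B'} {σ : A →+* A'} {ψ : B →+* B'}
    (h : ∀ a, ψ (algebraMap A B a) = algebraMap A' B' (σ a)) (hE : ∀ b ∈ E, ψ b ∈ E')
    (p : rees E) : reesEval E' (reesMap E E' σ ψ h hE p) = ψ (reesEval E p) := by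
  change eval 1 (Polynomial.map ψ (p : B[X])) = ψ (eval 1 (p : B[X]))
  rw [← map_one ψ, eval_map_apply]

/-- `1 ∈ E` as an element of degree `1` of `⨁ d, E ^ d`. -/
noncomputable def reesOne (E : Submodule A B) (h1 : 1 ∈ E) : rees E :=
  reesMonomial E 1 1 (by rwa [pow_one])

lemma reesOne_mem (E : Submodule A B) (h1 : 1 ∈ E) : reesOne E h1 ∈ reesGrading E 1 :=
  reesMonomial_mem _ _ _ _

lemma reesEval_reesOne (E : Submodule A B) (h1 : 1 ∈ E) : reesEval E (reesOne E h1) = 1 := by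
  change eval 1 (monomial 1 (1 : B)) = 1
  simp

lemma reesMap_reesOne {E : Submodule A B} {E' : Submodule A' B'} {σ : A →+* A'} {ψ : B →+* B'}
    (h : ∀ a, ψ (algebraMap A B a) = algebraMap A' B' (σ a)) (hE : ∀ b ∈ E, ψ b ∈ E')
    (h1 : 1 ∈ E) (h1' : 1 ∈ E') :
    reesMap E E' σ ψ h hE (reesOne E h1) = reesOne E' h1' := by
  apply Subtype.ext
  change Polynomial.map ψ (monomial 1 (1 : B)) = monomial 1 (1 : B')
  rw [map_monomial, map_one]

/-- The structure map of `A` into the degree `0` part of `⨁ d, E ^ d`. -/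
noncomputable def reesZero (E : Submodule A B) : A →+* reesGrading E 0 :=
  (algebraMap A (rees E)).codRestrict (SetLike.GradeZero.subring (reesGrading E))
    fun a ↦ SetLike.algebraMap_mem_graded _ a

lemma coe_reesZero (E : Submodule A B) (a : A) :
    (reesZero E a : rees E) = algebraMap A (rees E) a := rfl

lemma reesEval_reesZero (E : Submodule A B) (a : A) :
    reesEval E (reesZero E a) = algebraMap A B a := by
  change eval 1 (algebraMap A B[X] a) = _
  rw [Polynomial.algebraMap_apply, eval_C]

lemma reesMap_reesZero {E : Submodule A B} {E' : Submodule A' B'} {σ : A →+* A'} {ψ : B →+* B'}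
    (h : ∀ a, ψ (algebraMap A B a) = algebraMap A' B' (σ a)) (hE : ∀ b ∈ E, ψ b ∈ E') (a : A) :
    reesMap E E' σ ψ h hE (reesZero E a) = reesZero E' (σ a) := by
  apply Subtype.ext
  change Polynomial.map ψ (algebraMap A B[X] a) = algebraMap A' B'[X] (σ a)
  rw [Polynomial.algebraMap_apply, map_C, h, Polynomial.algebraMap_apply]

lemma exists_mem_pow {E : Submodule A B} {E' : Submodule A' B'} {σ : A →+* A'} {ψ : B →+* B'}
    (h : ∀ a, ψ (algebraMap A B a) = algebraMap A' B' (σ a)) (r : A)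
    (hσ : ∀ a', ∃ n : ℕ, ∃ a, σ a = σ r ^ n * a')
    (hE' : ∀ b' ∈ E', ∃ n : ℕ, ∃ b ∈ E, ψ b = algebraMap A' B' (σ r) ^ n * b')
    (d : ℕ) (b' : B') (hb' : b' ∈ E' ^ d) :
    ∃ n : ℕ, ∃ b ∈ E ^ d, ψ b = algebraMap A' B' (σ r) ^ n * b' := by
  induction d generalizing b' with
  | zero =>
    rw [pow_zero, Submodule.mem_one] at hb'
    obtain ⟨a', rfl⟩ := hb'
    obtain ⟨n, a, ha⟩ := hσ a'
    refine ⟨n, algebraMap A B a, ?_, by rw [h, ha, map_mul, map_pow]⟩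
    rw [pow_zero, Submodule.mem_one]
    exact ⟨a, rfl⟩
  | succ d ih =>
    rw [pow_succ] at hb' ⊢
    induction hb' using Submodule.mul_induction_on' with
    | mem_mul_mem x hx y hy =>
      obtain ⟨n, b, hb, hbx⟩ := ih x hx
      obtain ⟨m, c, hc, hcy⟩ := hE' y hy
      refine ⟨n + m, b * c, Submodule.mul_mem_mul hb hc, ?_⟩
      rw [map_mul, hbx, hcy, pow_add]; ring
    | add x _ y _ hx hy =>
      obtain ⟨n, b, hb, hbx⟩ := hx
      obtain ⟨m, c, hc, hcy⟩ := hy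
      refine ⟨n + m, r ^ m • b + r ^ n • c,
        Submodule.add_mem _ (Submodule.smul_mem _ _ hb) (Submodule.smul_mem _ _ hc), ?_⟩
      rw [map_add, Algebra.smul_def, Algebra.smul_def, map_mul, map_mul, hbx, hcy, h, h, map_pow,
        map_pow, map_pow, map_pow, pow_add]
      ring

end Algebra

section ProjLocalization

open HomogeneousLocalization Graded

variable {A B : Type u} [CommRing A] [CommRing B] {σ τ : Type u} [SetLike σ A] [SetLike τ B]
  [AddSubgroupClass σ A] [AddSubgroupClass τ B] (𝒜 : ℕ → σ) (ℬ : ℕ → τ)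
  [GradedRing 𝒜] [GradedRing ℬ]

/-- `φ` exhibits `ℬ` as the graded localization of `𝒜` at the degree `0` element `g`. -/
structure IsGradedAway (φ : 𝒜 →+*ᵍ ℬ) (g : A) : Prop where
  mem : g ∈ 𝒜 0
  isUnit : ∃ u ∈ ℬ 0, φ g * u = 1
  surj : ∀ d, ∀ b ∈ ℬ d, ∃ n : ℕ, ∃ a ∈ 𝒜 d, φ a = φ g ^ n * b
  eq_zero : ∀ a, φ a = 0 → ∃ n : ℕ, g ^ n * a = 0

variable {𝒜 ℬ} {φ : 𝒜 →+*ᵍ ℬ} {g : A}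

lemma IsGradedAway.irrelevant_le (h : IsGradedAway 𝒜 ℬ φ g) :
    HomogeneousIdeal.irrelevant ℬ ≤ (HomogeneousIdeal.irrelevant 𝒜).map φ := by
  refine (HomogeneousIdeal.irrelevant_le _).mpr fun d hd b hb ↦ ?_
  obtain ⟨u, -, hu⟩ := h.isUnit
  obtain ⟨n, a, ha, hab⟩ := h.surj d b hb
  have : b = u ^ n * φ a := by
    rw [hab, ← mul_assoc, ← mul_pow, mul_comm u, hu, one_pow, one_mul]
  rw [this]
  exact Ideal.mul_mem_left _ _
    (Ideal.mem_map_of_mem _ (HomogeneousIdeal.mem_irrelevant_of_mem _ hd ha))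

lemma val_fromZeroRingHom (P : Submonoid A) (a : 𝒜 0) :
    (fromZeroRingHom 𝒜 P a).val = algebraMap A _ (a : A) := rfl

lemma awayMap_fromZero (φ : 𝒜 →+*ᵍ ℬ) (s a : A) (ha : a ∈ 𝒜 0) :
    Away.map φ s (fromZeroRingHom 𝒜 (.powers s) ⟨a, ha⟩) =
      fromZeroRingHom ℬ (.powers (φ s)) ⟨φ a, map_mem φ ha⟩ := by
  apply val_injective
  change Localization.mk (φ a) ⟨φ 1, _⟩ = Localization.mk (φ a) 1
  congr 1
  exact Subtype.ext (map_one φ)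

lemma IsGradedAway.isLocalization (h : IsGradedAway 𝒜 ℬ φ g) {d : ℕ} (s : A) (hs : s ∈ 𝒜 d) :
    letI := (Away.map φ s).toAlgebra
    IsLocalization.Away (fromZeroRingHom 𝒜 (.powers s) ⟨g, h.mem⟩) (Away ℬ (φ s)) := by
  let := (Away.map φ s).toAlgebra
  obtain ⟨u, hu0, hu⟩ := h.isUnit
  have hG : IsUnit (Away.map φ s (fromZeroRingHom 𝒜 (.powers s) ⟨g, h.mem⟩)) := by
    refine IsUnit.of_mul_eq_one (fromZeroRingHom ℬ (.powers (φ s)) ⟨u, hu0⟩) ?_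
    rw [awayMap_fromZero, ← map_mul, ← map_one (fromZeroRingHom ℬ (.powers (φ s)))]
    congr 1
    exact Subtype.ext hu
  refine ⟨?_, ?_, ?_⟩
  · rintro ⟨_, n, rfl⟩
    change IsUnit (Away.map φ s (_ ^ n))
    rw [map_pow]
    exact hG.pow n
  · intro z
    obtain ⟨n, b, hb, rfl⟩ := Away.mk_surjective ℬ (map_mem φ hs) z
    obtain ⟨k, a, ha, hab⟩ := h.surj _ b hb
    refine ⟨⟨Away.mk 𝒜 hs n a ha, ⟨_, k, rfl⟩⟩, ?_⟩
    change _ * Away.map φ s (_ ^ k) = Away.map φ s _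
    rw [map_pow, awayMap_fromZero, Away.map_mk]
    apply val_injective
    rw [val_mul, val_pow, val_fromZeroRingHom, Away.val_mk, Away.val_mk, hab,
      ← map_pow (algebraMap B _), mul_comm,
      ← Localization.mk_one_eq_algebraMap, Localization.mk_mul, one_mul]
  · intro x y hxy
    change Away.map φ s x = Away.map φ s y at hxy
    rw [← sub_eq_zero, ← map_sub] at hxy
    suffices ∃ k : ℕ, (fromZeroRingHom 𝒜 (.powers s) ⟨g, h.mem⟩) ^ k * (x - y) = 0 by
      obtain ⟨k, hk⟩ := this
      exact ⟨⟨_, k, rfl⟩, sub_eq_zero.mp ((mul_sub _ _ _).symm.trans hk)⟩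
    generalize x - y = z at hxy
    obtain ⟨n, a, ha, rfl⟩ := Away.mk_surjective 𝒜 hs z
    rw [Away.map_mk] at hxy
    have := congr_arg val hxy
    rw [Away.val_mk, val_zero, Localization.mk_eq_mk', IsLocalization.mk'_eq_zero_iff] at this
    obtain ⟨⟨_, m, rfl⟩, hm⟩ := this
    change φ s ^ m * φ a = 0 at hm
    rw [← map_pow, ← map_mul] at hm
    obtain ⟨k, hk⟩ := h.eq_zero _ hm
    refine ⟨k, val_injective _ ?_⟩
    rw [val_mul, val_pow, val_fromZeroRingHom, Away.val_mk, val_zero, ← map_pow,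
      ← Localization.mk_one_eq_algebraMap, Localization.mk_mul, one_mul, Localization.mk_eq_mk',
      IsLocalization.mk'_eq_zero_iff]
    exact ⟨⟨_, m, rfl⟩, by change s ^ m * (g ^ k * a) = 0; rw [← hk]; ring⟩

variable (𝒜) in
/-- The structure morphism of `Proj 𝒜` over `Spec R`, for a ring homomorphism `R → 𝒜 0`. -/
noncomputable def projToSpec {R : Type u} [CommRing R] (ι : R →+* 𝒜 0) :
    Proj 𝒜 ⟶ Spec (.of R) :=
  Proj.toSpecZero 𝒜 ≫ Spec.map (CommRingCat.ofHom ι)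

lemma awayι_projToSpec {R : Type u} [CommRing R] (ι : R →+* 𝒜 0) {d : ℕ} (s : A) (hs : s ∈ 𝒜 d)
    (hd : 0 < d) :
    Proj.awayι 𝒜 s hs hd ≫ projToSpec 𝒜 ι =
      Spec.map (CommRingCat.ofHom ((fromZeroRingHom 𝒜 (.powers s)).comp ι)) := by
  rw [projToSpec, Proj.awayι_toSpecZero_assoc, ← Spec.map_comp]
  rfl

lemma IsGradedAway.isPullback {R R' : Type u} [CommRing R] [CommRing R'] (ι : R →+* 𝒜 0)
    (ι' : R' →+* ℬ 0) (ρ : R →+* R') (hρ : ∀ r, φ (ι r) = ι' (ρ r)) (r : R)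
    (hr : letI := ρ.toAlgebra; IsLocalization.Away r R')
    (h : IsGradedAway 𝒜 ℬ φ (ι r)) (hirr) :
    IsPullback (Proj.map φ hirr) (projToSpec ℬ ι') (projToSpec 𝒜 ι)
      (Spec.map (CommRingCat.ofHom ρ)) := by
  refine Scheme.isPullback_of_openCover _ _ _ _ (Proj.affineOpenCover 𝒜).openCover ?_
  rintro ⟨d, s, hs⟩
  have hd : 0 < (d : ℕ) := d.pos
  have h₁ : IsPullback (Proj.awayι ℬ (φ s) (map_mem φ hs) hd)
      (Spec.map (CommRingCat.ofHom (Away.map φ s))) (Proj.map φ hirr)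
      (Proj.awayι 𝒜 s hs hd) :=
    (IsOpenImmersion.isPullback _ _ _ _ (Proj.awayι_comp_map φ hirr hd s hs)
      (by rw [Proj.opensRange_awayι, Proj.opensRange_awayι, Proj.map_preimage_basicOpen])).flip
  have h₂ : IsPullback (Spec.map (CommRingCat.ofHom (Away.map φ s)))
      (Proj.awayι ℬ (φ s) (map_mem φ hs) hd ≫ projToSpec ℬ ι')
      (Proj.awayι 𝒜 s hs hd ≫ projToSpec 𝒜 ι) (Spec.map (CommRingCat.ofHom ρ)) := by
    rw [awayι_projToSpec, awayι_projToSpec]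
    let := ρ.toAlgebra
    let := (Away.map φ s).toAlgebra
    have hloc := h.isLocalization s hs
    have hloc' : IsLocalization
        ((Submonoid.powers r).map ((fromZeroRingHom 𝒜 (.powers s)).comp ι)) (Away ℬ (φ s)) := by
      rw [Submonoid.map_powers]
      exact hloc
    have : IsLocalization (Submonoid.powers r) R' := hr
    have H := CommRingCat.isPushout_of_isLocalization
      ((fromZeroRingHom 𝒜 (.powers s)).comp ι)
      ((fromZeroRingHom ℬ (.powers (φ s))).comp ι') (Rₘ := R') (Sₘ := Away ℬ (φ s))
      (by
        ext x : 1
        refine Eq.trans ?_ (awayMap_fromZero φ s _ (ι x).2).symm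
        change fromZeroRingHom ℬ _ (ι' (ρ x)) = _
        congr 1
        exact Subtype.ext (hρ x).symm) (.powers r)
    exact isPullback_SpecMap_of_isPushout _ _ _ _ H
  refine h₂.of_iso (h₁.isoPullback) (Iso.refl _) (Iso.refl _) (Iso.refl _) ?_ ?_ ?_ ?_
  · exact (Category.comp_id _).trans h₁.isoPullback_hom_snd.symm
  · exact (Category.comp_id _).trans (h₁.isoPullback_hom_fst_assoc _).symm
  · exact (Category.comp_id _).trans (Category.id_comp _).symm
  · exact (Category.comp_id _).trans (Category.id_comp _).symm

lemma projMap_congr {φ φ' : 𝒜 →+*ᵍ ℬ} (h : φ = φ') (hφ hφ') :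
    Proj.map φ hφ = Proj.map φ' hφ' := by
  subst h; rfl

variable (𝒜) in
/-- The morphism `Spec C ⟶ D₊(s) ⊆ Proj 𝒜` given by a ring homomorphism `A → C` that maps the
homogeneous element `s` to a unit. -/
noncomputable def specToProj {C : Type u} [CommRing C] (F : A →+* C) (s : A) (hF : IsUnit (F s))
    {d : ℕ} (hs : s ∈ 𝒜 d) (hd : 0 < d) : Spec (.of C) ⟶ Proj 𝒜 :=
  Spec.map (CommRingCat.ofHom ((IsLocalization.Away.lift (S := Localization.Away s) s hF).comp
    (algebraMap (Away 𝒜 s) (Localization.Away s)))) ≫ Proj.awayι 𝒜 s hs hd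

lemma specToProj_congr {C : Type u} [CommRing C] (F : A →+* C) {s s' : A} (h : s = s')
    (hF : IsUnit (F s)) {d : ℕ} (hs : s ∈ 𝒜 d) (hd : 0 < d) :
    specToProj 𝒜 F s hF hs hd = specToProj 𝒜 F s' (h ▸ hF) (h ▸ hs) hd := by
  subst h; rfl

lemma specToProj_projToSpec {C : Type u} [CommRing C] (F : A →+* C) (s : A) (hF : IsUnit (F s))
    {d : ℕ} (hs : s ∈ 𝒜 d) (hd : 0 < d) {R : Type u} [CommRing R] (ι : R →+* 𝒜 0) (G : R →+* C)
    (hG : ∀ r, F (ι r) = G r) :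
    specToProj 𝒜 F s hF hs hd ≫ projToSpec 𝒜 ι = Spec.map (CommRingCat.ofHom G) := by
  rw [specToProj, Category.assoc, awayι_projToSpec, ← Spec.map_comp, ← CommRingCat.ofHom_comp]
  congr 2
  ext r
  change IsLocalization.Away.lift s hF (algebraMap A _ (ι r : A)) = _
  rw [IsLocalization.Away.lift_eq, hG]

lemma specToProj_projMap {C D : Type u} [CommRing C] [CommRing D] (F : A →+* C) (s : A)
    (hF : IsUnit (F s)) {d : ℕ} (hs : s ∈ 𝒜 d) (hd : 0 < d) (G : B →+* D) (ψ : C →+* D)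
    (φ : 𝒜 →+*ᵍ ℬ) (hφ) (hψ : ∀ a, G (φ a) = ψ (F a)) :
    specToProj ℬ G (φ s) (by rw [hψ]; exact hF.map ψ) (map_mem φ hs) hd ≫ Proj.map φ hφ =
      Spec.map (CommRingCat.ofHom ψ) ≫ specToProj 𝒜 F s hF hs hd := by
  rw [specToProj, specToProj, Category.assoc, Proj.awayι_comp_map φ hφ hd s hs,
    ← Spec.map_comp_assoc, ← Spec.map_comp_assoc, ← CommRingCat.ofHom_comp,
    ← CommRingCat.ofHom_comp]
  congr 3
  ext z
  obtain ⟨n, a, ha, rfl⟩ := Away.mk_surjective 𝒜 hs z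
  rw [RingHom.comp_apply, Away.map_mk]
  simp only [RingHom.comp_apply, HomogeneousLocalization.algebraMap_apply, Away.val_mk,
    Localization.mk_eq_mk']
  have hFn : IsUnit (F (s ^ n)) := by rw [map_pow]; exact hF.pow n
  have hFn' : IsUnit (ψ (F (s ^ n))) := hFn.map ψ
  refine hFn'.mul_left_cancel ?_
  have e₁ : F (s ^ n) * IsLocalization.Away.lift s hF
      (IsLocalization.mk' (M := .powers s) (Localization.Away s) a ⟨s ^ n, n, rfl⟩) = F a := by
    rw [← IsLocalization.Away.lift_eq (S := Localization.Away s) s hF, ← map_mul]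
    exact (congr_arg _ (IsLocalization.mk'_spec' ..)).trans (IsLocalization.Away.lift_eq ..)
  have hG : IsUnit (G (φ s)) := by rw [hψ]; exact hF.map ψ
  have e₂ : G (φ s ^ n) * IsLocalization.Away.lift (φ s) hG
      (IsLocalization.mk' (M := .powers (φ s)) (Localization.Away (φ s)) (φ a)
        ⟨φ s ^ n, n, rfl⟩) = G (φ a) := by
    rw [← IsLocalization.Away.lift_eq (S := Localization.Away (φ s)) (φ s) hG, ← map_mul]
    exact (congr_arg _ (IsLocalization.mk'_spec' ..)).trans (IsLocalization.Away.lift_eq ..)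
  rw [← map_mul, ← hψ, map_pow]
  refine e₂.trans ?_
  rw [hψ]
  exact congr_arg ψ e₁.symm

end ProjLocalization

section Rees

variable {A B : Type u} [CommRing A] [CommRing B] [Algebra A B]
variable {A' B' : Type u} [CommRing A'] [CommRing B'] [Algebra A' B']

open Polynomial

lemma reesMap_isGradedAway {E : Submodule A B} {E' : Submodule A' B'} {σ : A →+* A'} {ψ : B →+* B'}
    (h : ∀ a, ψ (algebraMap A B a) = algebraMap A' B' (σ a)) (hE : ∀ b ∈ E, ψ b ∈ E') (r : A)
    (hr : IsUnit (σ r))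
    (hσ : ∀ a', ∃ n : ℕ, ∃ a, σ a = σ r ^ n * a')
    (hψ : ∀ b, ψ b = 0 → ∃ n : ℕ, algebraMap A B r ^ n * b = 0)
    (hE' : ∀ b' ∈ E', ∃ n : ℕ, ∃ b ∈ E, ψ b = algebraMap A' B' (σ r) ^ n * b') :
    IsGradedAway (reesGrading E) (reesGrading E') (reesMap E E' σ ψ h hE) (reesZero E r) where
  mem := (reesZero E r).2
  isUnit := by
    obtain ⟨u, hu⟩ := hr.exists_right_inv
    refine ⟨reesZero E' u, (reesZero E' u).2, ?_⟩
    rw [reesMap_reesZero, ← SetLike.GradeZero.coe_mul, ← map_mul, hu, map_one]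
    rfl
  surj d b' hb' := by
    obtain ⟨n, b, hb, hbb'⟩ := exists_mem_pow h r hσ hE' d _ (b'.2 d)
    refine ⟨n, reesMonomial E d b hb, reesMonomial_mem E d b hb, ?_⟩
    rw [eq_reesMonomial hb', reesMap_reesZero, coe_reesZero]
    apply Subtype.ext
    rw [MulMemClass.coe_mul, SubmonoidClass.coe_pow]
    change Polynomial.map ψ (monomial d b) = (algebraMap A' B'[X] (σ r)) ^ n * monomial d _
    rw [map_monomial, hbb', Polynomial.algebraMap_apply, ← C_pow, C_mul_monomial]
  eq_zero p hp := by
    have hp' (i : ℕ) : ψ ((p : B[X]).coeff i) = 0 := by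
      have := congr_arg (fun q : rees E' ↦ (q : B'[X]).coeff i) hp
      change (Polynomial.map ψ (p : B[X])).coeff i = 0 at this
      rwa [coeff_map] at this
    choose n hn using fun i ↦ hψ _ (hp' i)
    refine ⟨(p : B[X]).support.sup n, ?_⟩
    apply Subtype.ext
    rw [MulMemClass.coe_mul, SubmonoidClass.coe_pow, coe_reesZero]
    change (algebraMap A B[X] r) ^ _ * (p : B[X]) = 0
    rw [Polynomial.algebraMap_apply, ← C_pow]
    ext i
    rw [coeff_C_mul, coeff_zero]
    by_cases hi : i ∈ (p : B[X]).support
    · obtain ⟨k, hk⟩ := Nat.exists_eq_add_of_le (Finset.le_sup (f := n) hi)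
      rw [hk, add_comm, pow_add, mul_assoc, hn, mul_zero]
    · rw [notMem_support_iff.mp hi, mul_zero]

end Rees

open Graded

section Pairs

/-- A pair of schemes: `Y` and `X` are quasi-compact and quasi-separated, and `f : Y ⟶ X` is affine
and schematically dominant. The category of pairs of schemes is the full subcategory of
`Arrow Scheme` on such `f`, that is, morphisms of pairs are commutative squares. -/
class IsPair {Y X : Scheme.{u}} (f : Y ⟶ X) : Prop where
  compactSpace_left : CompactSpace Y
  quasiSeparatedSpace_left : QuasiSeparatedSpace Y
  compactSpace_right : CompactSpace X
  quasiSeparatedSpace_right : QuasiSeparatedSpace X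
  isAffineHom : IsAffineHom f
  isSchemeTheoreticallyDominant : IsSchemeTheoreticallyDominant f

attribute [instance] IsPair.isAffineHom

/-- The structure sheaf as a module over itself. -/
noncomputable abbrev structureModule (X : Scheme.{u}) : X.Modules :=
  SheafOfModules.unit X.ringCatSheaf

/-- `f^♯ : 𝒪_X ⟶ f_* 𝒪_Y`. -/
noncomputable def sharp {Y X : Scheme.{u}} (f : Y ⟶ X) :
    structureModule X ⟶ (Scheme.Modules.pushforward f).obj (structureModule Y) :=
  SheafOfModules.unitToPushforwardObjUnit f.toRingCatSheafHom

/-- A quasi-coherent `𝒪_X`-submodule of finite type `E` of `f_* 𝒪_Y` which contains the image of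
`𝒪_X`. -/
structure BlowUpModule {Y X : Scheme.{u}} (f : Y ⟶ X) where
  /-- the module `E` -/
  mod : X.Modules
  /-- the inclusion of `E` into `f_* 𝒪_Y` -/
  incl : mod ⟶ (Scheme.Modules.pushforward f).obj (structureModule Y)
  mono_incl : Mono incl
  isQuasicoherent : mod.IsQuasicoherent
  isFiniteType : mod.IsFiniteType
  exists_unit : ∃ e : structureModule X ⟶ mod, e ≫ incl = sharp f

/-- For a morphism of pairs `h = (h_Y, h_X)` from `f' : Y' ⟶ X'` to `f : Y ⟶ X`, the composition
`h_X^* E ⟶ h_X^* f_* 𝒪_Y ⟶ h_X^* (f h_Y)_* 𝒪_Y' = h_X^* (h_X f')_* 𝒪_Y' ⟶ f'_* 𝒪_Y'`. -/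
noncomputable def inverseImageHom {Y X Y' X' : Scheme.{u}} {f : Y ⟶ X} {f' : Y' ⟶ X'}
    (E : BlowUpModule f) (h : Arrow.mk f' ⟶ Arrow.mk f) :
    (Scheme.Modules.pullback h.right).obj E.mod ⟶
      (Scheme.Modules.pushforward f').obj (structureModule Y') :=
  (Scheme.Modules.pullback h.right).map (E.incl ≫
      (Scheme.Modules.pushforward f).map (sharp h.left) ≫
      (Scheme.Modules.pushforwardComp h.left f).hom.app _ ≫
      (Scheme.Modules.pushforwardCongr h.w).hom.app _ ≫
      (Scheme.Modules.pushforwardComp f' h.right).inv.app _) ≫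
    (Scheme.Modules.pullbackPushforwardAdjunction h.right).counit.app _

/-- The inverse image module `h⁻¹ E ⊆ f'_* 𝒪_Y'`. -/
noncomputable def inverseImageModule {Y X Y' X' : Scheme.{u}} {f : Y ⟶ X} {f' : Y' ⟶ X'}
    (E : BlowUpModule f) (h : Arrow.mk f' ⟶ Arrow.mk f) : X'.Modules :=
  Limits.image (inverseImageHom E h)

/-- A module is invertible if it is locally isomorphic to the structure sheaf. -/
def IsInvertibleModule {X : Scheme.{u}} (M : X.Modules) : Prop :=
  ∀ x : X, ∃ U : X.Opens, x ∈ U ∧ Nonempty (M.restrict U.ι ≅ structureModule U)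

end Pairs

section QuasiCoherent

variable {X : Scheme.{u}}

lemma appIso_fromSpec {U : X.Opens} (hU : IsAffineOpen U) (D : (Spec Γ(X, U)).Opens)
    (hD : hU.fromSpec ''ᵁ D ≤ U) (r : Γ(X, U)) :
    (hU.fromSpec.appIso D).inv ((Spec Γ(X, U)).presheaf.map D.leTop.op
      ((Scheme.ΓSpecIso Γ(X, U)).inv r)) = X.presheaf.map (homOfLE hD).op r := by
  have : (Scheme.ΓSpecIso Γ(X, U)).inv ≫ (Spec Γ(X, U)).presheaf.map D.leTop.op =
      X.presheaf.map (homOfLE hD).op ≫ (hU.fromSpec.appIso D).hom := by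
    rw [Scheme.Hom.appIso_hom', Scheme.Hom.map_appLE, Scheme.Hom.appLE, hU.fromSpec_app_self,
      Category.assoc, ← Functor.map_comp]
    rfl
  have h2 := congr((hU.fromSpec.appIso D).inv.hom ($(this).hom r))
  refine h2.trans ?_
  change ((hU.fromSpec.appIso D).hom ≫ (hU.fromSpec.appIso D).inv) _ = _
  rw [Iso.hom_inv_id]; rfl

lemma exists_section_of_basicOpen (M : X.Modules) (hM : M.IsQuasicoherent) {U : X.Opens}
    (hU : IsAffineOpen U) (g : Γ(X, U)) (x : Γ(M, X.basicOpen g)) :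
    ∃ (n : ℕ) (t : Γ(M, U)), M.presheaf.map (homOfLE (X.basicOpen_le g)).op t =
      (X.presheaf.map (homOfLE (X.basicOpen_le g)).op g) ^ n • x := by
  have hq : (M.restrict hU.fromSpec).IsQuasicoherent :=
    Scheme.Modules.isQuasicoherent_restrictFunctor hU.fromSpec M
  have hloc := (isIso_fromTildeΓ_iff_isLocalizing (M.restrict hU.fromSpec)).mp
    (Scheme.Modules.isIso_fromTildeΓ_of_isQuasicoherent _) g
  have hD : hU.fromSpec ''ᵁ PrimeSpectrum.basicOpen g = X.basicOpen g :=
    hU.fromSpec_image_basicOpen g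
  have hT : hU.fromSpec ''ᵁ ⊤ = U := by
    rw [Scheme.Hom.image_top_eq_opensRange, hU.opensRange_fromSpec]
  let y : Γ(M.restrict hU.fromSpec, PrimeSpectrum.basicOpen g) :=
    (M.presheaf.map (homOfLE hD.le).op x : Γ(M, hU.fromSpec ''ᵁ PrimeSpectrum.basicOpen g))
  obtain ⟨⟨t, _, n, rfl⟩, ht⟩ := hloc.surj (y := y)
  let t' : Γ(M, hU.fromSpec ''ᵁ ⊤) := t
  refine ⟨n, M.presheaf.map (homOfLE hT.ge).op t', ?_⟩
  have ht' : M.presheaf.map (homOfLE (hD.le.trans ((X.basicOpen_le g).trans hT.ge))).op t' =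
      (X.presheaf.map (homOfLE (hD.le.trans (X.basicOpen_le g))).op (g ^ n)) •
        M.presheaf.map (homOfLE hD.le).op x := by
    refine ht.symm.trans ?_
    rw [← appIso_fromSpec hU (PrimeSpectrum.basicOpen g)]
    rfl
  have h3 := congr(M.presheaf.map (homOfLE hD.ge).op $ht')
  rw [Scheme.Modules.map_smul] at h3
  simp only [← ConcreteCategory.comp_apply, ← Functor.map_comp] at h3 ⊢
  refine h3.trans ?_
  rw [← map_pow]
  congr 1
  exact congr($(M.presheaf.map_id _) x)

end QuasiCoherent

section Construction

variable {Y X : Scheme.{u}} {f : Y ⟶ X} (E : BlowUpModule f)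

/-- `Γ(Y, f ⁻¹ U)` as a `Γ(X, U)`-algebra via `f^♯`. -/
@[reducible] def algebraSections (f : Y ⟶ X) (U : X.Opens) : Algebra Γ(X, U) Γ(Y, f ⁻¹ᵁ U) :=
  (f.app U).hom.toAlgebra

attribute [local instance] algebraSections

/-- The sections of `E` over `U`, as a submodule of `Γ(U, f_* 𝒪_Y) = Γ(f ⁻¹ U, 𝒪_Y)`. -/
def BlowUpModule.sections (E : BlowUpModule f) (U : X.Opens) :
    Submodule Γ(X, U) Γ(Y, f ⁻¹ᵁ U) where
  carrier := { b | ∃ e : Γ(E.mod, U), E.incl.app U e = b }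
  add_mem' := by
    rintro _ _ ⟨e, rfl⟩ ⟨e', rfl⟩
    exact ⟨e + e', map_add _ _ _⟩
  zero_mem' := ⟨0, map_zero _⟩
  smul_mem' := by
    rintro a _ ⟨e, rfl⟩
    exact ⟨a • e, Scheme.Modules.Hom.app_smul _ _ _⟩

lemma BlowUpModule.one_mem (U : X.Opens) : 1 ∈ E.sections U := by
  obtain ⟨e, he⟩ := E.exists_unit
  refine ⟨e.app U (1 : Γ(X, U)), ?_⟩
  have := congr(($he).app U (1 : Γ(X, U)))
  refine Eq.trans this ?_
  exact map_one (f.app U).hom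

lemma app_restrict {U V : X.Opens} (i : U ≤ V) (a : Γ(X, V)) :
    (Y.presheaf.map (homOfLE (f.preimage_mono i)).op).hom (algebraMap Γ(X, V) Γ(Y, f ⁻¹ᵁ V) a) =
      algebraMap Γ(X, U) Γ(Y, f ⁻¹ᵁ U) ((X.presheaf.map (homOfLE i).op).hom a) :=
  congr($(f.naturality (homOfLE i).op) a).symm

lemma restrict_mem {U V : X.Opens} (i : U ≤ V) (b : Γ(Y, f ⁻¹ᵁ V)) (hb : b ∈ E.sections V) :
    (Y.presheaf.map (homOfLE (f.preimage_mono i)).op).hom b ∈ E.sections U := by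
  obtain ⟨e, rfl⟩ := hb
  exact ⟨E.mod.presheaf.map (homOfLE i).op e, congr($(E.incl.mapPresheaf.naturality (homOfLE i).op) e)⟩

/-- The restriction map of the graded algebras of sections of `⨁ d, E ^ d`. -/
noncomputable def BlowUpModule.res {U V : X.Opens} (i : U ≤ V) :
    reesGrading (E.sections V) →+*ᵍ reesGrading (E.sections U) :=
  reesMap _ _ _ _ (app_restrict i) (restrict_mem E i)

lemma BlowUpModule.res_id (U : X.Opens) : E.res (le_refl U) = .id _ := by
  ext p : 1
  apply Subtype.ext
  change Polynomial.map (Y.presheaf.map (𝟙 _)).hom (p : Polynomial Γ(Y, f ⁻¹ᵁ U)) = p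
  rw [CategoryTheory.Functor.map_id]
  exact Polynomial.map_id

lemma BlowUpModule.res_comp {U V W : X.Opens} (i : U ≤ V) (j : V ≤ W) :
    E.res (i.trans j) = (E.res i).comp (E.res j) := by
  ext p : 1
  apply Subtype.ext
  change Polynomial.map _ (p : Polynomial Γ(Y, f ⁻¹ᵁ W)) =
    Polynomial.map _ (Polynomial.map _ (p : Polynomial Γ(Y, f ⁻¹ᵁ W)))
  rw [Polynomial.map_map, ← CommRingCat.hom_comp, ← Functor.map_comp]
  rfl

lemma BlowUpModule.res_isGradedAway [IsAffineHom f] {V : X.Opens} (hV : IsAffineOpen V)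
    (g : Γ(X, V)) :
    IsGradedAway (reesGrading (E.sections V)) (reesGrading (E.sections (X.basicOpen g)))
      (E.res (X.basicOpen_le g)) (reesZero (E.sections V) g) := by
  have hloc := hV.isLocalization_basicOpen g
  have hlocY := (hV.preimage f).isLocalization_basicOpen (f.app V g)
  refine reesMap_isGradedAway _ _ g ?_ ?_ ?_ ?_
  · exact hloc.algebraMap_isUnit g
  · intro a'
    obtain ⟨⟨a, _, n, rfl⟩, ha⟩ := IsLocalization.surj (Submonoid.powers g) a'
    refine ⟨n, a, ?_⟩
    refine ha.symm.trans ?_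
    rw [map_pow, mul_comm]
    rfl
  · intro b hb
    have hb' : (Y.presheaf.map (homOfLE (Y.basicOpen_le (f.app V g))).op).hom b = 0 := by
      have e : Y.basicOpen (f.app V g) ≤ f ⁻¹ᵁ X.basicOpen g := (f.preimage_basicOpen g).ge
      have := congr((Y.presheaf.map (homOfLE e).op).hom $hb)
      rw [map_zero, ← CommRingCat.comp_apply, ← Functor.map_comp] at this
      exact this
    obtain ⟨⟨_, n, rfl⟩, hn⟩ := IsLocalization.exists_of_eq (M := Submonoid.powers (f.app V g))
      (hb'.trans (map_zero (algebraMap _ _)).symm)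
    exact ⟨n, hn.trans (mul_zero _)⟩
  · rintro _ ⟨x, rfl⟩
    obtain ⟨n, t, ht⟩ := exists_section_of_basicOpen E.mod E.isQuasicoherent hV g x
    refine ⟨n, _, ⟨t, rfl⟩, ?_⟩
    refine (congr($(E.incl.mapPresheaf.naturality (homOfLE (X.basicOpen_le g)).op) t)).symm.trans ?_
    refine (congr_arg (E.incl.app (X.basicOpen g)) ht).trans ?_
    refine (Scheme.Modules.Hom.app_smul _ _ _).trans ?_
    refine Eq.trans ?_ (congr_arg (· * (show Γ(Y, f ⁻¹ᵁ X.basicOpen g) from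
      E.incl.app (X.basicOpen g) x))
      (map_pow (algebraMap Γ(X, X.basicOpen g) Γ(Y, f ⁻¹ᵁ X.basicOpen g)) _ n))
    rfl

open Scheme

/-- The structure morphism `Proj (⨁ d, E(U) ^ d) ⟶ U` over an affine open `U`. -/
noncomputable def BlowUpModule.chartMap (U : X.AffineZariskiSite) :
    Proj (reesGrading (E.sections U.1)) ⟶ U.1 :=
  projToSpec _ (reesZero (E.sections U.1)) ≫ U.2.isoSpec.inv

/-- The morphism from the preimage of `U` to `Spec (⨁ d, E(U) ^ d)_{(s)} ⊆ Proj (⨁ d, E(U) ^ d)`,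
where `s` is `1 ∈ E(U)` in degree `1`, given by the sum map of `⨁ d, E(U) ^ d`. -/
noncomputable def BlowUpModule.liftChart (U : X.AffineZariskiSite) :
    (f ⁻¹ᵁ U.1).toScheme ⟶ Proj (reesGrading (E.sections U.1)) :=
  (f ⁻¹ᵁ U.1).toSpecΓ ≫ specToProj _ (reesEval (E.sections U.1))
    (reesOne (E.sections U.1) (E.one_mem U.1))
    (by rw [reesEval_reesOne]; exact isUnit_one) (reesOne_mem _ _) one_pos

lemma BlowUpModule.liftChart_chartMap (U : X.AffineZariskiSite) :
    E.liftChart U ≫ E.chartMap U ≫ U.1.ι = (f ⁻¹ᵁ U.1).ι ≫ f := by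
  have H := specToProj_projToSpec (reesEval (E.sections U.1))
    (reesOne (E.sections U.1) (E.one_mem U.1))
    (by rw [reesEval_reesOne]; exact isUnit_one) (reesOne_mem _ _) one_pos
    (reesZero (E.sections U.1)) (f.app U.1).hom (reesEval_reesZero _)
  rw [liftChart, chartMap, Category.assoc, Category.assoc, reassoc_of% H]
  refine (Scheme.Opens.toSpecΓ_naturality_assoc f U.1 _).trans ?_
  rw [U.2.isoSpec_inv_ι, U.2.toSpecΓ_fromSpec, morphismRestrict_ι]

variable [IsAffineHom f]

lemma BlowUpModule.res_irrelevant_le {U V : X.AffineZariskiSite} (i : U ≤ V) :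
    HomogeneousIdeal.irrelevant (reesGrading (E.sections U.1)) ≤
      (HomogeneousIdeal.irrelevant (reesGrading (E.sections V.1))).map
        (E.res (AffineZariskiSite.toOpens_mono i)) := by
  obtain ⟨g, hg⟩ := i
  obtain rfl : V.basicOpen g = U := Subtype.ext hg
  exact (E.res_isGradedAway V.2 g).irrelevant_le

/-- The functor sending an affine open `U` of `X` to `Proj (⨁ d, E(U) ^ d)`. -/
noncomputable def BlowUpModule.chartFunctor : X.AffineZariskiSite ⥤ Scheme.{u} where
  obj U := Proj (reesGrading (E.sections U.1))
  map i := Proj.map (E.res (AffineZariskiSite.toOpens_mono i.le)) (E.res_irrelevant_le i.le)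
  map_id U := (projMap_congr (E.res_id U.1) _ _).trans Proj.map_id
  map_comp _ _ := (projMap_congr (E.res_comp _ _) _ _).trans (Proj.map_comp ..)

lemma BlowUpModule.chart_isPullback {U V : X.AffineZariskiSite} (i : U ≤ V) :
    IsPullback
      (Proj.map (E.res (AffineZariskiSite.toOpens_mono i)) (E.res_irrelevant_le i))
      (projToSpec _ (reesZero (E.sections U.1))) (projToSpec _ (reesZero (E.sections V.1)))
      (Spec.map (X.presheaf.map (homOfLE (AffineZariskiSite.toOpens_mono i)).op)) := by
  obtain ⟨g, hg⟩ := i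
  obtain rfl : V.basicOpen g = U := Subtype.ext hg
  exact IsGradedAway.isPullback (φ := E.res (X.basicOpen_le g)) (reesZero (E.sections V.1))
    (reesZero (E.sections (X.basicOpen g))) (X.presheaf.map (homOfLE (X.basicOpen_le g)).op).hom
    (fun r ↦ reesMap_reesZero _ _ r) g
    (V.2.isLocalization_basicOpen g) (E.res_isGradedAway V.2 g)
    (E.res_isGradedAway V.2 g).irrelevant_le

lemma BlowUpModule.chartMap_isPullback {U V : X.AffineZariskiSite} (i : U ≤ V) :
    IsPullback
      (Proj.map (E.res (AffineZariskiSite.toOpens_mono i)) (E.res_irrelevant_le i))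
      (E.chartMap U) (E.chartMap V) (X.homOfLE (AffineZariskiSite.toOpens_mono i)) := by
  have H : Spec.map (X.presheaf.map (homOfLE (AffineZariskiSite.toOpens_mono i)).op) ≫
      V.2.isoSpec.inv = U.2.isoSpec.inv ≫ X.homOfLE (AffineZariskiSite.toOpens_mono i) := by
    rw [Iso.comp_inv_eq, Category.assoc, Iso.eq_inv_comp]
    exact Scheme.Opens.toSpecΓ_SpecMap_presheaf_map ..
  exact (E.chart_isPullback i).paste_vert (.of_vert_isIso ⟨H⟩)

/-- The gluing datum of the schemes `Proj (⨁ d, E(U) ^ d)`. -/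
noncomputable def BlowUpModule.gluingData :
    (AffineZariskiSite.directedCover X).RelativeGluingData where
  functor := E.chartFunctor
  natTrans :=
    { app := fun U ↦ E.chartMap U
      naturality := fun _ _ i ↦ (E.chartMap_isPullback i.le).w }
  equifibered := fun _ _ i ↦ E.chartMap_isPullback i.le

/-- The scheme `X_E = Proj_X (⨁ d, E ^ d)`, glued from `Proj (⨁ d, E(U) ^ d)` for `U` affine open
in `X`. Here `E ^ d ⊆ f_* 𝒪_Y` is the image of `E ^ ⊗ d`, whose sections over `U` are `E(U) ^ d`. -/
noncomputable def BlowUpModule.scheme : Scheme.{u} := E.gluingData.glued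

/-- The structure morphism `X_E ⟶ X`. -/
noncomputable def BlowUpModule.toBase : E.scheme ⟶ X := E.gluingData.toBase

/-- The inclusion `Proj (⨁ d, E(U) ^ d) ⟶ X_E`. -/
noncomputable def BlowUpModule.ι (U : X.AffineZariskiSite) :
    Proj (reesGrading (E.sections U.1)) ⟶ E.scheme :=
  E.gluingData.cover.f U

lemma BlowUpModule.ι_toBase (U : X.AffineZariskiSite) :
    E.ι U ≫ E.toBase = E.chartMap U ≫ U.1.ι :=
  E.gluingData.ι_toBase U

lemma BlowUpModule.projMap_ι {U V : X.AffineZariskiSite} (i : U ≤ V) :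
    Proj.map (E.res (AffineZariskiSite.toOpens_mono i)) (E.res_irrelevant_le i) ≫ E.ι V = E.ι U :=
  haveI : (E.gluingData.functor ⋙ Scheme.forget).IsLocallyDirected :=
    Scheme.Cover.RelativeGluingData.instIsLocallyDirectedI₀CompFunctorForgetOfIsThin ..
  colimit.w E.gluingData.functor (homOfLE i)

lemma BlowUpModule.liftChart_projMap {U V : X.AffineZariskiSite} (i : U ≤ V) :
    E.liftChart U ≫ Proj.map (E.res (AffineZariskiSite.toOpens_mono i)) (E.res_irrelevant_le i) =
      Y.homOfLE (f.preimage_mono (AffineZariskiSite.toOpens_mono i)) ≫ E.liftChart V := by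
  have H := specToProj_projMap (reesEval (E.sections V.1))
    (reesOne (E.sections V.1) (E.one_mem V.1))
    (by rw [reesEval_reesOne]; exact isUnit_one) (reesOne_mem _ _) one_pos
    (reesEval (E.sections U.1))
    (Y.presheaf.map (homOfLE (f.preimage_mono (AffineZariskiSite.toOpens_mono i))).op).hom
    (E.res (AffineZariskiSite.toOpens_mono i)) (E.res_irrelevant_le i)
    (reesEval_reesMap _ _)
  have e : E.res (AffineZariskiSite.toOpens_mono i) (reesOne (E.sections V.1) (E.one_mem V.1)) =
      reesOne (E.sections U.1) (E.one_mem U.1) := reesMap_reesOne _ _ _ _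
  rw [specToProj_congr (reesEval (E.sections U.1)) e] at H
  rw [liftChart, liftChart, Category.assoc, H]
  exact Scheme.Opens.toSpecΓ_SpecMap_presheaf_map_assoc _ _ _ _

lemma trans_pullback₁ (f : Y ⟶ X) {U V : X.AffineZariskiSite} (i : U ⟶ V) {Z : Scheme.{u}}
    (g : (f ⁻¹ᵁ V.1).toScheme ⟶ Z) :
    Cover.trans ((AffineZariskiSite.directedCover X).pullback₁ f) i ≫
      (pullbackRestrictIsoRestrict f V.1).hom ≫ g =
    (pullbackRestrictIsoRestrict f U.1).hom ≫
      Y.homOfLE (f.preimage_mono (AffineZariskiSite.toOpens_mono i.le)) ≫ g := by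
  let t : pullback f U.1.ι ⟶ pullback f V.1.ι :=
    Cover.trans ((AffineZariskiSite.directedCover X).pullback₁ f) i
  have ht : t ≫ pullback.fst f V.1.ι = pullback.fst f U.1.ι :=
    Cover.trans_map ((AffineZariskiSite.directedCover X).pullback₁ f) i
  have H : t ≫ (pullbackRestrictIsoRestrict f V.1).hom =
      (pullbackRestrictIsoRestrict f U.1).hom ≫
        Y.homOfLE (f.preimage_mono (AffineZariskiSite.toOpens_mono i.le)) := by
    rw [← cancel_mono (Scheme.Opens.ι _), Category.assoc, Category.assoc,
      pullbackRestrictIsoRestrict_hom_ι, Scheme.homOfLE_ι, pullbackRestrictIsoRestrict_hom_ι, ht]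
  exact (reassoc_of% H) g

lemma BlowUpModule.lift_compat {U V : X.AffineZariskiSite} (i : U ⟶ V) :
    Cover.trans ((AffineZariskiSite.directedCover X).pullback₁ f) i ≫
      (pullbackRestrictIsoRestrict f V.1).hom ≫ E.liftChart V ≫ E.ι V =
    (pullbackRestrictIsoRestrict f U.1).hom ≫ E.liftChart U ≫ E.ι U := by
  refine (trans_pullback₁ f i _).trans ?_
  rw [← E.projMap_ι i.le, reassoc_of% E.liftChart_projMap i.le]

/-- The morphism `f_E : Y ⟶ X_E`, with image in the open part of `X_E` where the section
`s = 1` of degree `1` is invertible, which glues the morphisms `BlowUpModule.liftChart`. -/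
noncomputable def BlowUpModule.lift : Y ⟶ E.scheme :=
  Scheme.OpenCover.glueMorphismsOfLocallyDirected
    ((AffineZariskiSite.directedCover X).pullback₁ f)
    (fun U : X.AffineZariskiSite ↦
      (pullbackRestrictIsoRestrict f U.1).hom ≫ E.liftChart U ≫ E.ι U)
    fun {U V} i ↦ E.lift_compat (U := U) (V := V) i

lemma BlowUpModule.ι_lift (U : X.AffineZariskiSite) :
    (f ⁻¹ᵁ U.1).ι ≫ E.lift = E.liftChart U ≫ E.ι U := by
  rw [← cancel_epi (pullbackRestrictIsoRestrict f U.1).hom, pullbackRestrictIsoRestrict_hom_ι_assoc]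
  exact Scheme.OpenCover.map_glueMorphismsOfLocallyDirected
    ((AffineZariskiSite.directedCover X).pullback₁ f) _ _ U

lemma BlowUpModule.lift_toBase : E.lift ≫ E.toBase = f := by
  refine Scheme.Cover.hom_ext ((AffineZariskiSite.directedCover X).pullback₁ f) _ _
    fun U : X.AffineZariskiSite ↦ ?_
  have := congr((pullbackRestrictIsoRestrict f U.1).hom ≫ $(E.ι_lift U) ≫ E.toBase)
  rw [Category.assoc, Category.assoc, pullbackRestrictIsoRestrict_hom_ι_assoc, E.ι_toBase,
    E.liftChart_chartMap, pullbackRestrictIsoRestrict_hom_ι_assoc] at this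
  exact this

end Construction

/-- The relative blow-up of the pair `f : Y ⟶ X` with respect to `E` is the pair
`E.lift : Y ⟶ E.scheme`, with the morphism of pairs `g_E = (id_Y, π_E)` to `f`. -/
noncomputable def BlowUpModule.relBlowUpHom {Y X : Scheme.{u}} {f : Y ⟶ X} [IsAffineHom f]
    (E : BlowUpModule f) : Arrow.mk E.lift ⟶ Arrow.mk f :=
  Arrow.homMk (𝟙 Y) E.toBase ((Category.id_comp f).trans E.lift_toBase.symm)

end RelBlowUp

/-! Uniqueness. Since `g_E` is the identity on `Y`, the component `Y' ⟶ Y` of a factorization must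
be `h_Y`. The component `X' ⟶ X_E` is then prescribed over `X` and after composition with `f'`. As
`π_E` is separated and `f'` is schematically dominant, at most one such morphism exists. The same
holds over every open of `X'`, so local solutions glue (`existsUnique_lift_of_local`).

Existence near `x ∈ X'`. An invertible quotient of `h_X^* E` is generated near `x` by the image of
one local section `e` of `E` (`exists_local_generator`). Write `ψ` for the map induced by `h_Y` on
functions, and regard `𝒪_X'` inside `f'_* 𝒪_Y'`. Every `b ∈ E` then satisfies `ψ b = a * ψ e` with
`a ∈ 𝒪_X'`. Because `1 ∈ E`, the element `ψ e` is a unit whose inverse `u` lies in `𝒪_X'`, so `u ^ d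
* ψ (E ^ d) ⊆ 𝒪_X'`. Hence `b T ^ d ↦ u ^ d * ψ b` is a ring homomorphism into `𝒪_X'` sending `e T`
to `1` (`exists_ringHom_of_generator`), and it defines a morphism to `D₊(e T)`. On `Y'` it differs
from evaluation at `T = 1` only by powers of the unit `u` in each degree, which does not affect the
map to `Proj` (`specToProj_eq_of_twist`).

The blow-up is a pair. `f_E` is affine because `π_E ∘ f_E = f` is affine and `π_E` is separated. It
is schematically dominant because the coordinate ring of each `D₊(t)` embeds into a localization of
functions on `Y` (`awayLift_reesEval_injective`). Finite generation of `E` on small affine opens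
gives quasi-compactness of `X_E`, and separatedness of `π_E` gives quasi-separatedness. -/

namespace RelBlowUp

open Graded

/-! ### Schematically dominant morphisms: uniqueness, gluing and a local criterion -/

section Dominant

/-- Morphisms over a separated base agree if they agree on a schematically dominant source. -/
lemma hom_ext_of_isSchemeTheoreticallyDominant {W X Y Z : Scheme.{u}} {g₁ g₂ : X ⟶ Y} (s : Y ⟶ Z)
    [IsSeparated s] (h : g₁ ≫ s = g₂ ≫ s) (ι : W ⟶ X) [IsSchemeTheoreticallyDominant ι]
    (hι : ι ≫ g₁ = ι ≫ g₂) : g₁ = g₂ := by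
  let X' : Over Z := Over.mk (g₁ ≫ s)
  let Y' : Over Z := Over.mk s
  let W' : Over Z := Over.mk (ι ≫ g₁ ≫ s)
  let g₁' : X' ⟶ Y' := Over.homMk g₁
  let g₂' : X' ⟶ Y' := Over.homMk g₂
  let ι' : W' ⟶ X' := Over.homMk ι
  have : IsSeparated Y'.hom := ‹_›
  let l : W' ⟶ equalizer g₁' g₂' := equalizer.lift ι' (by ext1; exact hι)
  have hl : l.left ≫ (equalizer.ι g₁' g₂').left = ι := by
    rw [← Over.comp_left, equalizer.lift_ι]; rfl
  -- The equalizer over `Z` is a closed immersion because `s` is separated. Since `ι` factors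
  -- through it, its ideal is contained in `ι.ker = ⊥`, so it is an isomorphism.
  have hker : (equalizer.ι g₁' g₂').left.ker = ⊥ := by
    rw [eq_bot_iff, ← ι.ker_eq_bot, ← hl]
    exact Scheme.Hom.le_ker_comp _ _
  have : IsIso (equalizer.ι g₁' g₂').left := IsClosedImmersion.isIso_iff_ker_eq_bot.mpr hker
  rw [← cancel_epi (equalizer.ι g₁' g₂').left]
  exact congr($(equalizer.condition g₁' g₂').left)

/-- Lifts through a separated morphism that are prescribed on a schematically dominant source
are unique and glue. -/
lemma existsUnique_lift_of_local {Y' X' Z X : Scheme.{u}} (f' : Y' ⟶ X')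
    [IsSchemeTheoreticallyDominant f'] [QuasiCompact f'] (π : Z ⟶ X) [IsSeparated π]
    (a : Y' ⟶ Z) (b : X' ⟶ X)
    (H : ∀ x : X', ∃ W : X'.Opens, x ∈ W ∧ ∃ k : W.toScheme ⟶ Z, k ≫ π = W.ι ≫ b ∧
      (f' ∣_ W) ≫ k = (f' ⁻¹ᵁ W).ι ≫ a) :
    ∃! k : X' ⟶ Z, k ≫ π = b ∧ f' ≫ k = a := by
  choose W hxW k hkπ hk using H
  have hW : IsOpenCover W := by
    rw [IsOpenCover, eq_top_iff]
    exact fun x _ ↦ Opens.mem_iSup.mpr ⟨x, hxW x⟩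
  have hk' (x : X') : pullback.snd f' (W x).ι ≫ k x = pullback.fst f' (W x).ι ≫ a := by
    rw [← cancel_epi (pullbackRestrictIsoRestrict f' (W x)).inv, ← Category.assoc,
      pullbackRestrictIsoRestrict_inv_fst_assoc, ← hk]
    congr 1
  let 𝒰 := X'.openCoverOfIsOpenCover W hW
  -- On the overlap the base change of the quasi-compact `f'` along the open immersion `p` is still
  -- schematically dominant, and both local lifts restrict to `a` along it.
  have hglue (x y : X') : pullback.fst (W x).ι (W y).ι ≫ k x =
      pullback.snd (W x).ι (W y).ι ≫ k y := by
    let p := pullback.fst (W x).ι (W y).ι ≫ (W x).ι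
    have hp : p = pullback.snd (W x).ι (W y).ι ≫ (W y).ι := pullback.condition
    refine hom_ext_of_isSchemeTheoreticallyDominant π ?_ (pullback.snd f' p) ?_
    · rw [Category.assoc, Category.assoc, hkπ, hkπ, ← Category.assoc, ← Category.assoc]
      exact congr_arg (· ≫ b) hp
    · trans pullback.fst f' p ≫ a
      · have := congr(pullback.map f' p f' (W x).ι (𝟙 _) (pullback.fst (W x).ι (W y).ι) (𝟙 _)
          (by simp) (by rw [Category.comp_id]) ≫ $(hk' x))
        rw [pullback.map, pullback.lift_snd_assoc, pullback.lift_fst_assoc] at this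
        simpa using this
      · have := congr(pullback.map f' p f' (W y).ι (𝟙 _) (pullback.snd (W x).ι (W y).ι) (𝟙 _)
          (by simp) (by rw [Category.comp_id, hp]) ≫ $(hk' y))
        rw [pullback.map, pullback.lift_snd_assoc, pullback.lift_fst_assoc] at this
        simpa using this.symm
  let K : X' ⟶ Z := Scheme.Cover.glueMorphisms 𝒰 k hglue
  have hK (x : X') : (W x).ι ≫ K = k x := Scheme.Cover.ι_glueMorphisms 𝒰 k hglue x
  have hKπ : K ≫ π = b := Scheme.Cover.hom_ext 𝒰 _ _ fun x : X' ↦ by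
    change (W x).ι ≫ _ = (W x).ι ≫ _
    rw [reassoc_of% hK x, hkπ]
  have hKf : f' ≫ K = a := by
    refine Scheme.Cover.hom_ext (𝒰.pullback₁ f') _ _ fun x : X' ↦ ?_
    change pullback.fst f' (W x).ι ≫ _ = pullback.fst f' (W x).ι ≫ _
    rw [pullback.condition_assoc, hK, hk']
  refine ⟨K, ⟨hKπ, hKf⟩, fun k' hk' ↦ ?_⟩
  exact hom_ext_of_isSchemeTheoreticallyDominant π (hk'.1.trans hKπ.symm) f' (hk'.2.trans hKf.symm)

/-- A quasi-compact morphism is schematically dominant if the coordinate rings of an affine open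
cover of the target inject into rings of functions over the source. -/
lemma isSchemeTheoreticallyDominant_of_cover {Y Z : Scheme.{u}} (l : Y ⟶ Z) [QuasiCompact l]
    (H : ∀ z : Z, ∃ (R B : CommRingCat.{u}) (j : Spec R ⟶ Z) (_ : IsOpenImmersion j)
      (k : Spec B ⟶ Y) (ρ : R ⟶ B), z ∈ j.opensRange ∧ Function.Injective ρ ∧
        k ≫ l = Spec.map ρ ≫ j) : IsSchemeTheoreticallyDominant l := by
  choose R B j hj' k ρ hj hρ H using H
  refine ⟨Scheme.IdealSheafData.ext_of_iSup_eq_top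
    (fun i ↦ ⟨(j i).opensRange, isAffineOpen_opensRange (j i)⟩) ?_ fun i ↦ ?_⟩
  · rw [eq_top_iff]
    exact fun z _ ↦ Opens.mem_iSup.mpr ⟨z, hj z⟩
  · rw [Scheme.Hom.ker_apply, Scheme.IdealSheafData.ideal_bot, Pi.bot_apply,
      ← RingHom.injective_iff_ker_eq_bot]
    set U := (j i).opensRange
    have hρ' : IsSchemeTheoreticallyDominant (Spec.map (ρ i)) := by
      refine ⟨Scheme.IdealSheafData.ext_of_isAffine ?_⟩
      rw [Scheme.Hom.ker_apply, Scheme.IdealSheafData.ideal_bot, Pi.bot_apply,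
        ← RingHom.injective_iff_ker_eq_bot]
      have e : (Spec.map (ρ i)).appTop =
          (Scheme.ΓSpecIso (R i)).hom ≫ ρ i ≫ (Scheme.ΓSpecIso (B i)).inv := by
        rw [← Scheme.ΓSpecIso_naturality_assoc, Iso.hom_inv_id, Category.comp_id]
      change Function.Injective (Spec.map (ρ i)).appTop
      rw [e]
      exact (((ConcreteCategory.bijective_of_isIso (Scheme.ΓSpecIso (B i)).inv).1.comp
        (hρ i)).comp (ConcreteCategory.bijective_of_isIso (Scheme.ΓSpecIso (R i)).hom).1)
    -- A section over `U` can be tested on `Spec R`. If it dies under `l`, it dies under `k ≫ l =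
    -- Spec.map ρ ≫ j`, and `Spec.map ρ` is injective on functions.
    have : IsIso ((j i).app U) := (j i).isIso_app U le_rfl
    rw [injective_iff_map_eq_zero]
    intro s hs
    have h1 : (k i ≫ l).app U s = 0 := by
      rw [Scheme.Hom.comp_app]
      exact (congr_arg _ hs).trans (map_zero ((k i).app (l ⁻¹ᵁ U)).hom)
    have h2 : (Spec.map (ρ i) ≫ j i).app U s = 0 := by
      rw [← H i]; exact h1
    rw [Scheme.Hom.comp_app] at h2
    refine (ConcreteCategory.bijective_of_isIso ((j i).app U)).1 ?_
    refine ((Spec.map (ρ i)).app_injective _ (h2.trans (map_zero _).symm)).trans (map_zero _).symm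

end Dominant

/-! ### Morphisms from affine schemes to `Proj` -/

section Proj

open HomogeneousLocalization Graded

variable {A : Type u} [CommRing A] {σ : Type u} [SetLike σ A] [AddSubgroupClass σ A] (𝒜 : ℕ → σ)
  [GradedRing 𝒜] {C : Type u} [CommRing C]

variable {𝒜} in
lemma lift_away_mk (F : A →+* C) {s : A} (hF : IsUnit (F s)) {d : ℕ} (hs : s ∈ 𝒜 d) (n : ℕ) (a : A)
    (ha : a ∈ 𝒜 (n • d)) :
    F s ^ n * IsLocalization.Away.lift (S := Localization.Away s) s hF
      (Away.mk 𝒜 hs n a ha).val = F a := by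
  rw [Away.val_mk, Localization.mk_eq_mk', ← map_pow,
    ← IsLocalization.Away.lift_eq (S := Localization.Away s) s hF, ← map_mul]
  exact (congr_arg _ (IsLocalization.mk'_spec' ..)).trans (IsLocalization.Away.lift_eq ..)

/-- Rescaling a ring homomorphism by powers of a unit, and changing the homogeneous element,
does not change the morphism to `Proj`. -/
lemma specToProj_eq_of_twist (F F' : A →+* C) (v : C)
    (h : ∀ n, ∀ a ∈ 𝒜 n, F' a = v ^ n * F a) {s s' : A} (hF : IsUnit (F s)) (hF' : IsUnit (F' s'))
    {d d' : ℕ} (hs : s ∈ 𝒜 d) (hs' : s' ∈ 𝒜 d') (hd : 0 < d) (hd' : 0 < d') :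
    specToProj 𝒜 F s hF hs hd = specToProj 𝒜 F' s' hF' hs' hd' := by
  -- `F' s' = v ^ d' * F s'` is a unit and `d'` is positive.
  have hv : IsUnit v := by
    have := hF'
    rw [h _ _ hs', ← Nat.succ_pred_eq_of_pos hd', pow_succ', mul_assoc] at this
    exact isUnit_of_mul_isUnit_left this
  -- Enlarging the denominator from `s` to `s * t` only shrinks the chart from `D₊(s)` to `D₊(s *
  -- t)`. Both sides can thus be compared on `D₊(s * s')`.
  have step (G : A →+* C) {s t : A} (hGs : IsUnit (G s)) (hGt : IsUnit (G t)) {d e : ℕ}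
      (hs : s ∈ 𝒜 d) (ht : t ∈ 𝒜 e) (hd : 0 < d) :
      specToProj 𝒜 G s hGs hs hd = specToProj 𝒜 G (s * t) (by rw [map_mul]; exact hGs.mul hGt)
        (SetLike.mul_mem_graded hs ht) (hd.trans_le (d.le_add_right e)) := by
    rw [specToProj, specToProj, ← Proj.SpecMap_awayMap_awayι 𝒜 hs hd ht rfl, ← Spec.map_comp_assoc,
      ← CommRingCat.ofHom_comp]
    congr 3
    ext z
    obtain ⟨n, a, ha, rfl⟩ := Away.mk_surjective 𝒜 hs z
    refine (hGs.pow n).mul_left_cancel ?_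
    refine (lift_away_mk G hGs hs n a ha).trans ?_
    have := lift_away_mk G (s := s * t) (by rw [map_mul]; exact hGs.mul hGt)
      (SetLike.mul_mem_graded hs ht) n (a * t ^ n)
      (by rw [smul_add]; exact SetLike.mul_mem_graded ha (SetLike.pow_mem_graded n ht))
    refine (hGt.pow n).mul_right_cancel ?_
    rw [← map_pow, ← map_mul, ← this, mul_right_comm]
    refine congr_arg₂ (· * ·) (by rw [map_pow, map_mul, mul_pow]) ?_
    change _ = IsLocalization.Away.lift (S := Localization.Away (s * t)) _
      (by rw [map_mul]; exact hGs.mul hGt) (awayMap 𝒜 ht rfl _).val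
    congr 1
    exact (Away.val_mk ..).trans (val_awayMap_mk 𝒜 ht rfl (n • d) ⟨a, ha⟩ n _).symm
  have hs'F : IsUnit (F s') := by
    rw [h _ _ hs'] at hF'; exact isUnit_of_mul_isUnit_right hF'
  have hsF' : IsUnit (F' s) := by
    rw [h _ _ hs]; exact (hv.pow d).mul hF
  have hm : IsUnit (F (s * s')) := by rw [map_mul]; exact hF.mul hs'F
  have hm' : IsUnit (F' (s * s')) := by rw [map_mul]; exact hsF'.mul hF'
  -- On a degree-zero fraction the powers of `v` in numerator and denominator cancel. Two degrees
  -- are kept since `d + d'` and `d' + d` agree only propositionally.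
  have key (e e' : ℕ) (hee' : e = e') (hdeg : s * s' ∈ 𝒜 e) (hdeg' : s * s' ∈ 𝒜 e')
      (he : 0 < e) (he' : 0 < e') :
      specToProj 𝒜 F (s * s') hm hdeg he = specToProj 𝒜 F' (s * s') hm' hdeg' he' := by
    subst hee'
    rw [specToProj, specToProj]
    congr 3
    ext z
    obtain ⟨n, a, ha, rfl⟩ := Away.mk_surjective 𝒜 hdeg z
    refine (hm'.pow n).mul_left_cancel ?_
    refine Eq.trans ?_ (lift_away_mk F' hm' hdeg n a ha).symm
    rw [h _ _ ha, h _ _ hdeg, ← lift_away_mk F hm hdeg n a ha,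
      mul_pow, ← pow_mul, mul_assoc, smul_eq_mul, mul_comm n]
    rfl
  rw [step F hF hs'F hs hs' hd, step F' hF' hsF' hs' hs hd', specToProj_congr F' (mul_comm s' s)]
  exact key _ _ (add_comm _ _) _ _ _ _

end Proj

/-! ### Local generators of an invertible quotient -/

section Invertible

open Scheme

lemma sharp_ne_zero {Y X : Scheme.{u}} [Nonempty Y] (f : Y ⟶ X) : sharp f ≠ 0 := by
  intro h
  have h1 : f.app ⊤ (1 : Γ(X, ⊤)) = 0 := congr(($h).app ⊤ (1 : Γ(X, ⊤)))
  have h2 : (1 : Γ(Y, f ⁻¹ᵁ ⊤)) = 0 := (map_one (f.app ⊤).hom).symm.trans h1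
  have : Nonempty (f ⁻¹ᵁ (⊤ : X.Opens)) := ⟨⟨Classical.arbitrary Y, trivial⟩⟩
  exact one_ne_zero h2

lemma sharp_fromSpecResidueField_ne_zero {U : Scheme.{u}} (x : U) :
    sharp (U.fromSpecResidueField x) ≠ 0 := by
  have : Nonempty (Spec (U.residueField x)) := ⟨IsLocalRing.closedPoint (U.residueField x)⟩
  exact sharp_ne_zero _

lemma presheaf_map_map (X : Scheme.{u}) {U V W : X.Opensᵒᵖ} (i : U ⟶ V) (j : V ⟶ W) (k : U ⟶ W)
    (s : X.presheaf.obj U) : X.presheaf.map j (X.presheaf.map i s) = X.presheaf.map k s := by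
  rw [← CommRingCat.comp_apply, ← Functor.map_comp]
  rfl

/-- `Spec κ(x)` maps only to `x`, so a nonempty non-vanishing locus upstairs can only come from `x`.
-/
lemma mem_basicOpen_of_fromSpecResidueField {U : Scheme.{u}} (x : U) (D : U.Opens) (d : Γ(U, D))
    (h : (U.fromSpecResidueField x).app D d ≠ 0) : x ∈ U.basicOpen d := by
  have h1 : (Spec (U.residueField x)).basicOpen ((U.fromSpecResidueField x).app D d) ≠ ⊥ := by
    rwa [Ne, basicOpen_eq_bot_iff]
  obtain ⟨p, hp⟩ := Opens.ne_bot_iff_nonempty _ |>.mp h1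
  rw [← Scheme.preimage_basicOpen] at hp
  have : U.fromSpecResidueField x p ∈ U.basicOpen d := hp
  rwa [fromSpecResidueField_apply] at this

/-- If an invertible module is a quotient of the pullback of `M`, then locally it is generated by
a section of `M`. -/
lemma exists_local_generator {X X' : Scheme.{u}} (g : X' ⟶ X) (M : X.Modules) (I : X'.Modules)
    (φ : (Modules.pullback g).obj M ⟶ I) [Epi φ] {U : X'.Opens}
    (θ : I.restrict U.ι ≅ structureModule U) (x : X') (hx : x ∈ U) :
    ∃ (V : X.Opens) (_ : IsAffineOpen V) (W : X'.Opens) (hW : W ≤ g ⁻¹ᵁ V) (m : Γ(M, V)), x ∈ W ∧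
      ∀ s : Γ(I, W), ∃ a : Γ(X', W), s = a • I.presheaf.map (homOfLE hW).op
        (((Modules.pullbackPushforwardAdjunction g).homEquiv _ _ φ).app V m) := by
  -- Evaluation in the residue field at `x` is a nonzero map `β` out of `I` restricted to `U`.
  -- Adjunctions and the epimorphism `φ` turn it into a nonzero map out of `M`, so some section `m₀`
  -- of `M` has nonzero value at `x`. This replaces an argument with stalks.
  let i := U.toScheme.fromSpecResidueField ⟨x, hx⟩
  let β : I.restrict U.ι ⟶ (Modules.pushforward i).obj (structureModule _) := θ.hom ≫ sharp i
  let q := (Modules.restrictAdjunction U.ι).homEquiv _ _ β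
  let ε := (Modules.pullbackPushforwardAdjunction g).homEquiv _ _ φ
  have hβ : β ≠ 0 := fun h ↦ sharp_fromSpecResidueField_ne_zero (U := U.toScheme) _ (by
    rw [← cancel_epi θ.hom, comp_zero]; exact h)
  have hq : q ≠ 0 := fun h ↦ hβ (by
    apply ((Modules.restrictAdjunction U.ι).homEquiv _ _).injective
    refine h.trans ?_
    rw [Adjunction.homEquiv_unit, Functor.map_zero, comp_zero])
  have hφq : φ ≫ q ≠ 0 := fun h ↦ hq (by rw [← cancel_epi φ, h, comp_zero])
  have hε : ε ≫ (Modules.pushforward g).map q ≠ 0 := fun h ↦ hφq (by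
    apply ((Modules.pullbackPushforwardAdjunction g).homEquiv _ _).injective
    rw [Adjunction.homEquiv_naturality_right]
    refine h.trans ?_
    rw [Adjunction.homEquiv_unit, Functor.map_zero, comp_zero])
  obtain ⟨V₀, m₀, hm₀⟩ : ∃ (V₀ : X.Opens) (m₀ : Γ(M, V₀)),
      (ε ≫ (Modules.pushforward g).map q).app V₀ m₀ ≠ 0 := by
    by_contra! H
    exact hε (Modules.hom_ext _ _ fun V ↦ by ext m; exact H V m)
  let D₀ : U.toScheme.Opens := U.ι ⁻¹ᵁ g ⁻¹ᵁ V₀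
  let s₀ : Γ(I, g ⁻¹ᵁ V₀) := ε.app V₀ m₀
  let d₀ : Γ(U, D₀) :=
    θ.hom.app D₀ (I.presheaf.map (homOfLE (U.ι.image_preimage_le (g ⁻¹ᵁ V₀))).op s₀)
  have hd₀ : (⟨x, hx⟩ : U) ∈ U.toScheme.basicOpen d₀ := by
    refine mem_basicOpen_of_fromSpecResidueField _ _ _ fun h ↦ hm₀ ?_
    change ((Modules.restrictAdjunction U.ι).homEquiv _ _ β).app (g ⁻¹ᵁ V₀) s₀ = 0
    rw [Adjunction.homEquiv_unit]
    exact h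
  have hgx : g x ∈ V₀ := U.toScheme.basicOpen_le d₀ hd₀
  obtain ⟨_, ⟨V, hV, rfl⟩, hxV, hVV₀ : V ≤ V₀⟩ :=
    X.isBasis_affineOpens.exists_subset_of_mem_open hgx V₀.isOpen
  -- On `D` the coordinate `d₀` of the section in the trivialization `θ` is invertible, and `D` maps
  -- into the affine open `V`.
  let D : U.toScheme.Opens := U.toScheme.basicOpen d₀ ⊓ U.ι ⁻¹ᵁ g ⁻¹ᵁ V
  have hD : D ≤ D₀ := inf_le_left.trans (U.toScheme.basicOpen_le d₀)
  have hW : U.ι ''ᵁ D ≤ g ⁻¹ᵁ V := by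
    rintro _ ⟨y, hy, rfl⟩
    exact hy.2
  refine ⟨V, hV, U.ι ''ᵁ D, hW, M.presheaf.map (homOfLE hVV₀).op m₀, ⟨⟨x, hx⟩, ⟨hd₀, hxV⟩, rfl⟩, ?_⟩
  intro s
  let s₁ : Γ(I, U.ι ''ᵁ D) :=
    I.presheaf.map (homOfLE (hW.trans (g.preimage_mono hVV₀))).op s₀
  have hs₁ : I.presheaf.map (homOfLE hW).op (ε.app V (M.presheaf.map (homOfLE hVV₀).op m₀)) = s₁ := by
    have := congr($(ε.mapPresheaf.naturality (homOfLE hVV₀).op) m₀)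
    refine (congr_arg (I.presheaf.map (homOfLE hW).op) this).trans ?_
    change (I.presheaf.map _ ≫ I.presheaf.map _) _ = _
    rw [← Functor.map_comp]
    rfl
  have hθ : θ.hom.app D s₁ = (U.toScheme.presheaf.map (homOfLE hD).op d₀ : Γ(U, D)) := by
    have := congr($(θ.hom.mapPresheaf.naturality (homOfLE hD).op)
      (I.presheaf.map (homOfLE (U.ι.image_preimage_le (g ⁻¹ᵁ V₀))).op s₀))
    refine Eq.trans ?_ this
    refine congr_arg (θ.hom.app D) ?_
    change _ = (I.presheaf.map _ ≫ I.presheaf.map _) _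
    rw [← Functor.map_comp]
    rfl
  have hu : IsUnit (U.toScheme.presheaf.map (homOfLE hD).op d₀) := by
    have e : U.toScheme.presheaf.map (homOfLE hD).op =
        U.toScheme.presheaf.map (homOfLE (U.toScheme.basicOpen_le d₀)).op ≫
        U.toScheme.presheaf.map (homOfLE (inf_le_left : D ≤ U.toScheme.basicOpen d₀)).op := by
      rw [← Functor.map_comp]; rfl
    rw [e]
    exact (RingedSpace.isUnit_res_basicOpen U.toScheme.toRingedSpace d₀).map
      (U.toScheme.presheaf.map (homOfLE (inf_le_left : D ≤ U.toScheme.basicOpen d₀)).op).hom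
  obtain ⟨v, hv⟩ := hu.exists_left_inv
  -- The coefficient is the quotient of the coordinates of `s` and of the generator.
  let c : Γ(U, D) := (show Γ(U, D) from θ.hom.app D s) * v
  refine ⟨(U.ι.appIso D).inv c, ?_⟩
  rw [hs₁]
  have hinj : Function.Injective (θ.hom.app D) := by
    refine Function.LeftInverse.injective (g := θ.inv.app D) fun y ↦ ?_
    exact congr(($(θ.hom_inv_id)).app D y)
  refine hinj ?_
  have h3 : θ.hom.app D ((U.ι.appIso D).inv c • s₁) = c • θ.hom.app D s₁ :=
    Modules.Hom.app_smul θ.hom c s₁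
  refine Eq.trans ?_ h3.symm
  rw [hθ]
  change (show Γ(U, D) from θ.hom.app D s) = c * _
  rw [mul_assoc, hv, mul_one]

end Invertible

/-! ### The inverse image module in terms of functions -/

section InverseImage

open Scheme

variable {Y X Y' X' : Scheme.{u}} {f : Y ⟶ X} {f' : Y' ⟶ X'}

attribute [local instance] algebraSections

/-- The map from `h_X^* E` onto its image is an epimorphism, so `exists_local_generator` applies.
The inclusion of the image into `f'_* 𝒪_Y'` turns the relation between sections into one between
functions on `Y'`. -/
lemma exists_local_generator_sections (E : BlowUpModule f) (hY : Y' ⟶ Y) (hX : X' ⟶ X)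
    (w : hY ≫ f = f' ≫ hX)
    (hE : IsInvertibleModule (inverseImageModule E (Arrow.homMk (f := Arrow.mk f') (g := Arrow.mk f)
      hY hX w))) (x : X') :
    ∃ (V : X.AffineZariskiSite) (W : X'.Opens) (_ : x ∈ W) (_ : W ≤ hX ⁻¹ᵁ V.1)
      (hYW : f' ⁻¹ᵁ W ≤ hY ⁻¹ᵁ f ⁻¹ᵁ V.1), ∃ e ∈ E.sections V.1, ∀ b ∈ E.sections V.1,
        ∃ a : Γ(X', W), hY.appLE (f ⁻¹ᵁ V.1) (f' ⁻¹ᵁ W) hYW b =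
          f'.app W a * hY.appLE (f ⁻¹ᵁ V.1) (f' ⁻¹ᵁ W) hYW e := by
  let h : Arrow.mk f' ⟶ Arrow.mk f := Arrow.homMk hY hX w
  let φ : (Modules.pullback hX).obj E.mod ⟶
    (Modules.pushforward f').obj (structureModule Y') := inverseImageHom E h
  obtain ⟨U, hxU, ⟨θ⟩⟩ := hE x
  have : Epi (factorThruImage φ) := inferInstance
  obtain ⟨V, hV, W, hW, m, hxW, H⟩ := exists_local_generator hX E.mod
    (image φ) (factorThruImage (φ)) θ x hxU
  let ε := (Modules.pullbackPushforwardAdjunction hX).homEquiv E.mod (image φ)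
    (factorThruImage (φ))
  have hYW : f' ⁻¹ᵁ W ≤ hY ⁻¹ᵁ f ⁻¹ᵁ V := by
    have e : hY ⁻¹ᵁ f ⁻¹ᵁ V = f' ⁻¹ᵁ hX ⁻¹ᵁ V := congr(($(w)) ⁻¹ᵁ V)
    rw [e]
    exact f'.preimage_mono hW
  -- Passing to the adjoint removes the pullback: on sections of `E` the composite is just `h_Y^♯`.
  have hε : ε ≫ (Modules.pushforward hX).map (image.ι (φ)) =
      E.incl ≫ (Modules.pushforward f).map (sharp hY) ≫
      (Modules.pushforwardComp hY f).hom.app _ ≫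
      (Modules.pushforwardCongr w).hom.app _ ≫
      (Modules.pushforwardComp f' hX).inv.app _ := by
    rw [← Adjunction.homEquiv_naturality_right, image.fac, ← Equiv.eq_symm_apply,
      Adjunction.homEquiv_counit]
    rfl
  have key (m : Γ(E.mod, V)) : (image.ι (φ)).app W
      ((image φ).presheaf.map (homOfLE hW).op (ε.app V m)) =
      hY.appLE (f ⁻¹ᵁ V) (f' ⁻¹ᵁ W) hYW (E.incl.app V m) := by
    have h1 := congr($((image.ι (φ)).mapPresheaf.naturality (homOfLE hW).op)
      (ε.app V m))
    refine h1.trans ?_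
    have h2 := congr(($hε).app V m)
    refine (congr_arg (((Modules.pushforward f').obj (structureModule Y')).presheaf.map
      (homOfLE hW).op) h2).trans ?_
    exact presheaf_map_map Y' _ _ _ (hY.app (f ⁻¹ᵁ V) (E.incl.app V m))
  refine ⟨⟨V, hV⟩, W, hxW, hW, hYW, _, ⟨m, rfl⟩, ?_⟩
  rintro _ ⟨m', rfl⟩
  obtain ⟨a, ha⟩ := H ((image φ).presheaf.map (homOfLE hW).op (ε.app V m'))
  refine ⟨a, ?_⟩
  rw [← key, ← key]
  refine (congr_arg ((image.ι (φ)).app W) ha).trans ?_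
  exact Modules.Hom.app_smul (image.ι (φ)) a _

end InverseImage

/-! ### Finite generation of `E` on affine opens -/

section FiniteType

open Scheme Modules

/-- A module of finite type is, on an affine open cover, generated by finitely many sections. -/
lemma exists_affineOpen_generatingSections {X : Scheme.{u}} (M : X.Modules)
    (hM : M.IsFiniteType) (x : X) :
    ∃ (U : X.Opens) (_ : IsAffineOpen U) (_ : x ∈ U)
      (σ : (M.restrict U.ι).GeneratingSections), σ.IsFiniteType := by
  obtain ⟨⟨I, W, cov, gen⟩, hfin⟩ := hM.exists_localGeneratorsData
  rw [Opens.coversTop_iff] at cov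
  have hx : x ∈ iSup W := by rw [cov]; trivial
  obtain ⟨i, hxi⟩ := Opens.mem_iSup.mp hx
  obtain ⟨_, ⟨U, hU, rfl⟩, hxU, hUW : U ≤ W i⟩ :=
    X.isBasis_affineOpens.exists_subset_of_mem_open hxi (W i).isOpen
  let r := X.homOfLE hUW
  have : PreservesColimitsOfSize.{u, u} (restrictFunctor r) := inferInstance
  let F : SheafOfModules.{u} (X.ringCatSheaf.over (W i)) ⥤
      SheafOfModules.{u} (Scheme.ringCatSheaf U) := (overEquiv (W i)).functor ⋙ restrictFunctor r
  have : PreservesColimitsOfSize.{u, u} F :=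
    comp_preservesColimits (overEquiv (W i)).functor (restrictFunctor r)
  let iso : SheafOfModules.overFunctor X.ringCatSheaf _ ⋙ F ≅ restrictFunctor (Scheme.Opens.ι U) :=
    (Functor.associator _ _ _).symm ≪≫
      Functor.isoWhiskerRight (overFunctorEquiv _) _ ≪≫
      (restrictFunctorComp _ _).symm ≪≫ (restrictFunctorCongr (X.homOfLE_ι hUW))
  exact ⟨U, hU, hxU, SheafOfModules.GeneratingSections.equivOfIso (iso.app M)
    ((gen i).map F (restrictUnitIso _).symm), ⟨(hfin.isFiniteType i).finite⟩⟩

lemma exists_generatingSections_fromSpec {X : Scheme.{u}} (M : X.Modules)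
    (hM : M.IsFiniteType) (x : X) :
    ∃ (U : X.Opens) (hU : IsAffineOpen U) (_ : x ∈ U)
      (σ : (M.restrict hU.fromSpec).GeneratingSections), σ.IsFiniteType := by
  obtain ⟨U, hU, hxU, σ, hσ⟩ := exists_affineOpen_generatingSections M hM x
  let F : SheafOfModules.{u} (Scheme.ringCatSheaf U) ⥤
      SheafOfModules.{u} (Spec Γ(X, U)).ringCatSheaf := restrictFunctor hU.isoSpec.inv
  have : PreservesColimitsOfSize.{u, u} F :=
    (restrictAdjunction hU.isoSpec.inv).leftAdjoint_preservesColimits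
  let iso := (restrictFunctorComp hU.isoSpec.inv U.ι).symm ≪≫
    restrictFunctorCongr hU.isoSpec_inv_ι
  exact ⟨U, hU, hxU, SheafOfModules.GeneratingSections.equivOfIso (iso.app M)
    (σ.map F (restrictUnitIso _).symm), ⟨hσ.finite⟩⟩

lemma hom_ext_of_generatingSections {C : Type*} [Category* C] {J : GrothendieckTopology C}
    {R : Sheaf J RingCat.{u}} [HasWeakSheafify J AddCommGrpCat.{u}]
    [J.WEqualsLocallyBijective AddCommGrpCat.{u}] {M N : SheafOfModules.{u} R}
    (σ : M.GeneratingSections) (p q : M ⟶ N)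
    (h : ∀ i, SheafOfModules.sectionsMap p (σ.s i) = SheafOfModules.sectionsMap q (σ.s i)) :
    p = q := by
  rw [← cancel_epi σ.π, SheafOfModules.freeHomEquiv_symm_comp,
    SheafOfModules.freeHomEquiv_symm_comp]
  exact congr_arg _ (funext h)

/-- The sections generate `N` a priori only as a sheaf. The map from `N` to the sheaf of the
quotient of `Γ(N, ⊤)` by their span kills all generators, hence vanishes; faithfulness of `tilde`
makes the quotient map zero. -/
lemma span_generatingSections {R : CommRingCat.{u}} (N : (Spec R).Modules) [IsIso N.fromTildeΓ]
    (σ : N.GeneratingSections) :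
    Submodule.span R (Set.range fun i ↦ (show Γ(N, ⊤) from (σ.s i).val (op ⊤))) = ⊤ := by
  let z (i : σ.I) : Γ(N, ⊤) := (σ.s i).val (op ⊤)
  let P : ModuleCat.{u} R := ModuleCat.of R Γ(N, ⊤)
  let Q : Submodule R P := Submodule.span R (Set.range z)
  change Q = ⊤
  let π : P ⟶ ModuleCat.of R (P ⧸ Q) := ModuleCat.ofHom Q.mkQ
  let q : N ⟶ tilde (ModuleCat.of R (P ⧸ Q)) := inv N.fromTildeΓ ≫ tilde.map π
  have hq (i) : q.app ⊤ (z i) = 0 := by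
    have h1 : N.fromTildeΓ.app ⊤ ((tilde.toOpen P ⊤) (z i)) = z i := by
      have := congr($(N.toOpen_fromTildeΓ_app ⊤) (z i))
      refine this.trans ?_
      exact congr($(N.presheaf.map_id _) (z i))
    have h2 : (tilde.map π).app ⊤ ((tilde.toOpen P ⊤) (z i)) = tilde.toOpen _ ⊤ (π (z i)) :=
      congr($(tilde.toOpen_map_app π ⊤) (z i))
    have h3 : π (z i) = 0 :=
      (Submodule.Quotient.mk_eq_zero _).mpr (Submodule.subset_span ⟨i, rfl⟩)
    have h4 : q.app ⊤ (N.fromTildeΓ.app ⊤ ((tilde.toOpen P ⊤) (z i))) =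
        (tilde.map π).app ⊤ ((tilde.toOpen P ⊤) (z i)) := by
      have : N.fromTildeΓ ≫ q = tilde.map π := IsIso.hom_inv_id_assoc _ _
      exact congr(($this).app ⊤ ((tilde.toOpen P ⊤) (z i)))
    rw [h1, h2, h3, map_zero] at h4
    exact h4
  have hq0 : q = 0 := by
    refine hom_ext_of_generatingSections (R := (Spec R).ringCatSheaf) σ q _ fun i ↦ ?_
    apply Subtype.ext
    funext U
    have hs : N.presheaf.map (homOfLE (le_top : U.unop ≤ ⊤)).op (z i) = (σ.s i).val U :=
      (σ.s i).property (homOfLE (le_top : U.unop ≤ ⊤)).op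
    change q.app U.unop ((σ.s i).val U) = 0
    rw [← hs]
    refine (congr($(q.mapPresheaf.naturality (homOfLE (le_top : U.unop ≤ ⊤)).op) (z i))).trans ?_
    change ((tilde _).presheaf.map _) (q.app ⊤ (z i)) = 0
    rw [hq, map_zero]
  have hπ : tilde.map π = 0 := by
    refine (cancel_epi (inv N.fromTildeΓ)).mp (Eq.trans ?_ comp_zero.symm)
    exact hq0
  have : π = 0 := (tilde.functor R).map_injective (hπ.trans tilde.map_zero.symm)
  rw [← Submodule.ker_mkQ Q, LinearMap.ker_eq_top]
  exact congr(($this).hom)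

attribute [local instance] algebraSections

/-- This is the form in which finite type enters; it serves the quasi-compactness of `X_E`. -/
lemma BlowUpModule.exists_affineOpen_fg {Y X : Scheme.{u}} {f : Y ⟶ X} (E : BlowUpModule f)
    (x : X) : ∃ U : X.AffineZariskiSite, x ∈ U.1 ∧ (E.sections U.1).FG := by
  obtain ⟨U, hU, hxU, σ, hσ⟩ := exists_generatingSections_fromSpec E.mod E.isFiniteType x
  have hq : (E.mod.restrict hU.fromSpec).IsQuasicoherent :=
    have := E.isQuasicoherent
    isQuasicoherent_restrictFunctor hU.fromSpec E.mod
  have : IsIso (E.mod.restrict hU.fromSpec).fromTildeΓ := isIso_fromTildeΓ_of_isQuasicoherent _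
  have hspan := span_generatingSections _ σ
  have hT : hU.fromSpec ''ᵁ ⊤ = U := by
    rw [Scheme.Hom.image_top_eq_opensRange, hU.opensRange_fromSpec]
  let τ : Γ(E.mod.restrict hU.fromSpec, ⊤) →+ Γ(Y, f ⁻¹ᵁ U) :=
    (E.incl.app U).hom.comp (E.mod.presheaf.map (homOfLE hT.ge).op).hom
  -- The scalars act on the source through functions on `Spec Γ(X, U)`; `appIso_fromSpec` matches
  -- that action with the one on `E`.
  have hτ (r : Γ(X, U)) (t) : τ (r • t) = r • τ t := by
    have h1 : (r • t : Γ(E.mod.restrict hU.fromSpec, ⊤)) =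
        (show Γ(E.mod, hU.fromSpec ''ᵁ ⊤) from
          X.presheaf.map (homOfLE hT.le).op r • (show Γ(E.mod, hU.fromSpec ''ᵁ ⊤) from t)) := by
      rw [← appIso_fromSpec hU ⊤]
      rfl
    have h2 : E.mod.presheaf.map (homOfLE hT.ge).op (r • t : Γ(E.mod.restrict hU.fromSpec, ⊤)) =
        r • E.mod.presheaf.map (homOfLE hT.ge).op (show Γ(E.mod, hU.fromSpec ''ᵁ ⊤) from t) := by
      rw [h1]
      refine (Modules.map_smul E.mod _ _ _).trans ?_
      congr 1
      refine (presheaf_map_map X _ _ (𝟙 _) r).trans ?_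
      rw [CategoryTheory.Functor.map_id]; rfl
    exact (congr_arg (E.incl.app U) h2).trans (Modules.Hom.app_smul E.incl r _)
  let τ' : Γ(E.mod.restrict hU.fromSpec, ⊤) →ₗ[Γ(X, U)] Γ(Y, f ⁻¹ᵁ U) :=
    { τ with map_smul' := hτ }
  have hrange : E.sections U = LinearMap.range τ' := by
    ext b
    constructor
    · rintro ⟨e, rfl⟩
      refine ⟨E.mod.presheaf.map (homOfLE hT.le).op e, congr_arg (E.incl.app U) ?_⟩
      change (E.mod.presheaf.map _ ≫ E.mod.presheaf.map _) e = e
      rw [← Functor.map_comp]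
      exact congr($(E.mod.presheaf.map_id _) e)
    · rintro ⟨t, rfl⟩
      exact ⟨_, rfl⟩
  refine ⟨⟨U, hU⟩, hxU, ?_⟩
  change (E.sections U).FG
  rw [hrange, LinearMap.range_eq_map, ← hspan]
  have := hσ.finite
  exact (Submodule.fg_span (Set.finite_range _)).map τ'

end FiniteType

/-! ### Charts of `Proj (⨁ d, E ^ d)` -/

section ProjRees

open HomogeneousLocalization Polynomial

section

variable {A : Type u} [CommRing A] {σ : Type u} [SetLike σ A] [AddSubgroupClass σ A] (𝒜 : ℕ → σ)
  [GradedRing 𝒜] {C D : Type u} [CommRing C] [CommRing D]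

/-- The ring homomorphism underlying `specToProj`. -/
noncomputable def awayLift (F : A →+* C) {s : A} (hF : IsUnit (F s)) : Away 𝒜 s →+* C :=
  (IsLocalization.Away.lift (S := Localization.Away s) s hF).comp
    (algebraMap (Away 𝒜 s) (Localization.Away s))

variable {𝒜} in
lemma awayLift_mk (F : A →+* C) {s : A} (hF : IsUnit (F s)) {d : ℕ} (hs : s ∈ 𝒜 d) (n : ℕ) (a : A)
    (ha : a ∈ 𝒜 (n • d)) : F s ^ n * awayLift 𝒜 F hF (Away.mk 𝒜 hs n a ha) = F a :=
  lift_away_mk F hF hs n a ha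

lemma specToProj_eq (F : A →+* C) {s : A} (hF : IsUnit (F s)) {d : ℕ} (hs : s ∈ 𝒜 d)
    (hd : 0 < d) : specToProj 𝒜 F s hF hs hd =
      Spec.map (CommRingCat.ofHom (awayLift 𝒜 F hF)) ≫ Proj.awayι 𝒜 s hs hd := rfl

lemma specMap_specToProj (ψ : C →+* D) (F : A →+* C) {s : A} (hF : IsUnit (F s)) {d : ℕ}
    (hs : s ∈ 𝒜 d) (hd : 0 < d) :
    Spec.map (CommRingCat.ofHom ψ) ≫ specToProj 𝒜 F s hF hs hd =
      specToProj 𝒜 (ψ.comp F) s (hF.map ψ) hs hd := by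
  rw [specToProj_eq, specToProj_eq, ← Spec.map_comp_assoc, ← CommRingCat.ofHom_comp]
  congr 3
  ext z
  obtain ⟨n, a, ha, rfl⟩ := Away.mk_surjective 𝒜 hs z
  refine ((hF.map ψ).pow n).mul_left_cancel ?_
  refine Eq.trans ?_ (awayLift_mk (ψ.comp F) (hF.map ψ) hs n a ha).symm
  rw [RingHom.comp_apply, RingHom.comp_apply, ← awayLift_mk F hF hs n a ha, map_mul, map_pow]

end

variable {A B : Type u} [CommRing A] [CommRing B] [Algebra A B] (E : Submodule A B)

lemma reesEval_reesMonomial (d : ℕ) (b : B) (hb : b ∈ E ^ d) :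
    reesEval E (reesMonomial E d b hb) = b := by
  change eval 1 (monomial d b) = b
  simp

variable {E} in
-- In a single degree the sum map is the inclusion `E ^ d ⊆ B`. Homogeneity matters: if `1 ∈ E`,
-- then `T - 1` evaluates to `0`.
lemma eq_zero_of_reesEval {d : ℕ} {p : rees E} (hp : p ∈ reesGrading E d)
    (h : reesEval E p = 0) : p = 0 := by
  rw [eq_reesMonomial hp] at h ⊢
  rw [reesEval_reesMonomial] at h
  apply Subtype.ext
  change monomial d _ = (0 : B[X])
  rw [h, map_zero]

lemma isUnit_algebraMap_reesEval (t : rees E) :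
    IsUnit (((algebraMap B (Localization.Away (reesEval E t))).comp (reesEval E)) t) :=
  IsLocalization.Away.algebraMap_isUnit (S := Localization.Away (reesEval E t)) (reesEval E t)

/-- The coordinate ring of `D₊(t)` embeds into the localization of `B` at `t`. -/
lemma awayLift_reesEval_injective {d : ℕ} {t : rees E} (ht : t ∈ reesGrading E d) :
    Function.Injective (awayLift (reesGrading E) _ (isUnit_algebraMap_reesEval E t)) := by
  rw [injective_iff_map_eq_zero]
  intro z hz
  obtain ⟨n, a, ha, rfl⟩ := Away.mk_surjective (reesGrading E) ht z
  have h1 := awayLift_mk ((algebraMap B (Localization.Away (reesEval E t))).comp (reesEval E))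
    (isUnit_algebraMap_reesEval E t) ht n a ha
  rw [hz, mul_zero] at h1
  have h2 : algebraMap B (Localization.Away (reesEval E t)) (reesEval E a) = 0 := h1.symm
  obtain ⟨⟨_, m, rfl⟩, hm⟩ := (IsLocalization.map_eq_zero_iff (Submonoid.powers (reesEval E t))
    (Localization.Away (reesEval E t)) _).mp h2
  -- This product is homogeneous, so its vanishing can be checked in `B`.
  have h3 : t ^ m * a = 0 := by
    refine eq_zero_of_reesEval (SetLike.mul_mem_graded (SetLike.pow_mem_graded m ht) ha) ?_
    rw [map_mul, map_pow]
    exact hm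
  apply val_injective
  rw [Away.val_mk, val_zero, Localization.mk_eq_mk', IsLocalization.mk'_eq_zero_iff]
  exact ⟨⟨_, m, rfl⟩, h3⟩

/-- The algebra is generated in degree one: `E ^ (k + 1) = E ^ k * E`, so positive degrees lie in
the ideal of the generators `t T`. -/
lemma irrelevant_le_span_reesMonomial (T : Set B) (hT : Submodule.span A T = E) :
    (HomogeneousIdeal.irrelevant (reesGrading E)).toIdeal ≤ Ideal.span (Set.range fun t : T ↦
      reesMonomial E 1 t (by rw [pow_one, ← hT]; exact Submodule.subset_span t.2)) := by
  set J : Ideal (rees E) := Ideal.span (Set.range fun t : T ↦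
      reesMonomial E 1 t (by rw [pow_one, ← hT]; exact Submodule.subset_span t.2))
  have hone (y : B) (hy : y ∈ Submodule.span A T) :
      reesMonomial E 1 y (by rwa [pow_one, ← hT]) ∈ J := by
    induction hy using Submodule.span_induction with
    | mem t ht => exact Ideal.subset_span ⟨⟨t, ht⟩, rfl⟩
    | zero =>
      convert! J.zero_mem
      apply Subtype.ext
      exact map_zero _
    | add x y _ _ hx hy =>
      convert! J.add_mem hx hy using 1
      apply Subtype.ext
      exact map_add (monomial 1) x y
    | smul a x _ hx =>
      convert! J.mul_mem_left (algebraMap A (rees E) a) hx using 1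
      apply Subtype.ext
      change monomial 1 (a • x) = algebraMap A B[X] a * monomial 1 x
      rw [Polynomial.algebraMap_apply, C_mul_monomial, Algebra.smul_def]
  have hsucc (k : ℕ) (b : B) (hb : b ∈ E ^ k * E) :
      reesMonomial E (k + 1) b (by rwa [pow_succ]) ∈ J := by
    induction hb using Submodule.mul_induction_on' with
    | mem_mul_mem x hx y hy =>
      convert! J.mul_mem_left (reesMonomial E k x hx) (hone y (hT ▸ hy)) using 1
      apply Subtype.ext
      exact (monomial_mul_monomial k 1 x y).symm
    | add x _ y _ hx hy =>
      convert! J.add_mem hx hy using 1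
      apply Subtype.ext
      exact map_add (monomial (k + 1)) x y
  refine (HomogeneousIdeal.toIdeal_irrelevant_le _).mpr fun d hd p hp ↦ ?_
  obtain ⟨k, rfl⟩ := Nat.exists_eq_succ_of_ne_zero hd.ne'
  have hp' : p ∈ reesGrading E (k + 1) := hp
  rw [eq_reesMonomial hp']
  exact hsucc k _ (by rw [← pow_succ]; exact p.2 (k + 1))

lemma compactSpace_proj_rees (hE : E.FG) : CompactSpace (Proj (reesGrading E)) := by
  obtain ⟨T, hT⟩ := hE
  have h := Proj.iSup_basicOpen_eq_top (reesGrading E) _ (irrelevant_le_span_reesMonomial E T hT)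
  rw [← isCompact_univ_iff, ← Opens.coe_top, ← h, Opens.coe_iSup]
  exact isCompact_iUnion fun t ↦
    (Proj.isAffineOpen_basicOpen _ _ (reesMonomial_mem E 1 _ _) one_pos).isCompact

end ProjRees

/-! ### The relative blow-up is a pair -/

section Structure

open Scheme

attribute [local instance] algebraSections

variable {Y X : Scheme.{u}} {f : Y ⟶ X} [IsAffineHom f] (E : BlowUpModule f)

lemma BlowUpModule.isPullback_ι (U : X.AffineZariskiSite) :
    IsPullback (E.chartMap U) (E.ι U) U.1.ι E.toBase :=
  E.gluingData.isPullback_natTrans_ι_toBase U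

instance (U : X.AffineZariskiSite) : IsOpenImmersion (E.ι U) :=
  MorphismProperty.of_isPullback (E.isPullback_ι U) (inferInstanceAs (IsOpenImmersion U.1.ι))

lemma BlowUpModule.mem_opensRange_ι (U : X.AffineZariskiSite) (z : E.scheme)
    (hz : E.toBase z ∈ U.1) : z ∈ (E.ι U).opensRange := by
  have h := E.gluingData.toBase_preimage_eq_opensRange_ι U
  have : z ∈ E.toBase ⁻¹ᵁ (U.1.ι).opensRange := by
    rw [Scheme.Opens.opensRange_ι]; exact hz
  rw [show E.toBase ⁻¹ᵁ (U.1.ι).opensRange = (E.ι U).opensRange from h] at this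
  exact this

/-- Separatedness is local on `X`, and over an affine open the morphism is a `Proj` over its
degree-zero part followed by affine morphisms. -/
instance : IsSeparated E.toBase := by
  refine IsZariskiLocalAtTarget.of_openCover (P := @IsSeparated)
    (AffineZariskiSite.directedCover X) fun U : X.AffineZariskiSite ↦ ?_
  have h1 : IsSeparated (E.chartMap U) := by
    rw [BlowUpModule.chartMap, projToSpec]; infer_instance
  have h2 := (E.isPullback_ι U).flip.isoPullback_inv_snd
  change IsSeparated (pullback.snd E.toBase U.1.ι)
  rw [← h2]
  infer_instance

lemma BlowUpModule.compactSpace_scheme [CompactSpace X] : CompactSpace E.scheme := by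
  choose U hU hfg using E.exists_affineOpen_fg
  obtain ⟨T, hT⟩ := isCompact_univ.elim_finite_subcover (fun x ↦ ((U x).1 : Set X))
    (fun x ↦ (U x).1.isOpen) fun x _ ↦ Set.mem_iUnion.mpr ⟨x, hU x⟩
  have h : (⋃ x ∈ T, Set.range (E.ι (U x))) = Set.univ := by
    rw [Set.eq_univ_iff_forall]
    intro z
    obtain ⟨x, hx, hz⟩ := Set.mem_iUnion₂.mp (hT (Set.mem_univ (E.toBase z)))
    exact Set.mem_iUnion₂.mpr ⟨x, hx, E.mem_opensRange_ι (U x) z hz⟩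
  rw [← isCompact_univ_iff, ← h]
  refine T.isCompact_biUnion fun x _ ↦ ?_
  have := compactSpace_proj_rees _ (hfg x)
  exact isCompact_range (E.ι (U x)).continuous

instance : IsAffineHom E.lift := by
  have : IsAffineHom (E.lift ≫ E.toBase) := by rwa [E.lift_toBase]
  exact IsAffineHom.of_comp E.lift E.toBase

lemma BlowUpModule.fromSpec_lift (U : X.AffineZariskiSite) :
    (U.2.preimage f).fromSpec ≫ E.lift =
      specToProj _ (reesEval (E.sections U.1)) (reesOne (E.sections U.1) (E.one_mem U.1))
        (by rw [reesEval_reesOne]; exact isUnit_one) (reesOne_mem _ _) one_pos ≫ E.ι U := by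
  rw [← (U.2.preimage f).isoSpec_inv_ι, Category.assoc, E.ι_lift, BlowUpModule.liftChart,
    Category.assoc, (U.2.preimage f).isoSpec_inv_toSpecΓ_assoc]

/-- `f_E` is defined through the chart of `s = 1 · T`. Where `t` is invertible it can equally be
described in the chart `D₊(t)`, as the dominance test requires. -/
lemma BlowUpModule.specMap_fromSpec_lift (U : X.AffineZariskiSite) {d : ℕ}
    {t : rees (E.sections U.1)} (ht : t ∈ reesGrading (E.sections U.1) d) (hd : 0 < d) :
    (Spec.map (CommRingCat.ofHom (algebraMap Γ(Y, f ⁻¹ᵁ U.1)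
      (Localization.Away (reesEval (E.sections U.1) t)))) ≫ (U.2.preimage f).fromSpec) ≫ E.lift =
    Spec.map (CommRingCat.ofHom
      (awayLift (reesGrading (E.sections U.1)) _ (isUnit_algebraMap_reesEval _ t))) ≫
      Proj.awayι _ t ht hd ≫ E.ι U := by
  rw [Category.assoc, E.fromSpec_lift, ← Category.assoc, ← Category.assoc, ← specToProj_eq]
  congr 1
  refine (specMap_specToProj _ _ _ _ _ _).trans ?_
  -- The ring homomorphism is unchanged, hence the twist `1`; only the denominator moves from `s` to
  -- `t`.
  refine specToProj_eq_of_twist (𝒜 := reesGrading (E.sections U.1)) _ _ 1 ?_ _ _ _ _ _ _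
  intro n a _
  rw [one_pow, one_mul]

lemma BlowUpModule.exists_mem_opensRange_awayι (z : E.scheme) :
    ∃ (U : X.AffineZariskiSite) (d : ℕ) (t : rees (E.sections U.1))
      (ht : t ∈ reesGrading (E.sections U.1) d) (hd : 0 < d),
      z ∈ (Proj.awayι (reesGrading (E.sections U.1)) t ht hd ≫ E.ι U).opensRange := by
  obtain ⟨U, w, hw⟩ : ∃ (U : X.AffineZariskiSite) (w : Proj (reesGrading (E.sections U.1))),
      E.ι U w = z := E.gluingData.cover.exists_eq z
  obtain ⟨⟨d, t⟩, v, hv⟩ :=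
    (Proj.affineOpenCover (reesGrading (E.sections U.1))).openCover.exists_eq w
  exact ⟨U, d, t, t.2, d.2, v, (congr_arg (E.ι U) hv).trans hw⟩

instance : IsSchemeTheoreticallyDominant E.lift := by
  refine isSchemeTheoreticallyDominant_of_cover E.lift fun z ↦ ?_
  obtain ⟨U, d, t, ht, hd, hz⟩ := E.exists_mem_opensRange_awayι z
  exact ⟨_, _, Proj.awayι _ t ht hd ≫ E.ι U, inferInstance, _, _, hz,
    awayLift_reesEval_injective _ ht, E.specMap_fromSpec_lift U ht hd⟩

lemma BlowUpModule.isPair_lift [IsPair f] : IsPair E.lift where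
  compactSpace_left := IsPair.compactSpace_left f
  quasiSeparatedSpace_left := IsPair.quasiSeparatedSpace_left f
  compactSpace_right := have := IsPair.compactSpace_right f; E.compactSpace_scheme
  quasiSeparatedSpace_right :=
    have := IsPair.quasiSeparatedSpace_right f
    quasiSeparatedSpace_of_quasiSeparated E.toBase
  isAffineHom := inferInstance
  isSchemeTheoreticallyDominant := inferInstance

end Structure

/-! ### Dividing by a generator -/

section

open Polynomial

variable {A B A' B' : Type u} [CommRing A] [CommRing B] [CommRing A'] [CommRing B'] [Algebra A B]

/-- If the inverse image of `E` is generated by the image of `e ∈ E`, dividing by `e` defines a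
ring homomorphism on `⨁ d, E ^ d`. -/
lemma exists_ringHom_of_generator (E : Submodule A B) (ψ : B →+* B') (φ : A' →+* B')
    (hφ : Function.Injective φ) (χ : A →+* A') (hχ : ∀ a, φ (χ a) = ψ (algebraMap A B a))
    (e : B) (he : e ∈ E) (h1 : (1 : B) ∈ E) (H : ∀ b ∈ E, ∃ a, ψ b = φ a * ψ e) :
    ∃ (F : rees E →+* A') (u : A'),
      (∀ n, ∀ p ∈ reesGrading E n, φ (F p) = φ u ^ n * ψ (reesEval E p)) ∧
      F (reesMonomial E 1 e (by rwa [pow_one])) = 1 ∧ ∀ a, F (reesZero E a) = χ a := by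
  -- Applied to `1 ∈ E`, the hypothesis gives `1 = φ u * ψ e`: the inverse of `ψ e` comes from `A'`.
  obtain ⟨u, hu⟩ := H 1 h1
  rw [map_one] at hu
  let G : rees E →+* B' := (eval₂RingHom ψ (φ u)).comp (rees E).val.toRingHom
  have hG (n : ℕ) (p : rees E) (hp : p ∈ reesGrading E n) :
      G p = φ u ^ n * ψ (reesEval E p) := by
    rw [eq_reesMonomial hp, reesEval_reesMonomial]
    change eval₂ ψ (φ u) (monomial n _) = _
    rw [eval₂_monomial, mul_comm]
  -- For `y ∈ E` with `ψ y = φ a * ψ e`, one factor `φ u` cancels `ψ e`, which leaves `φ a`.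
  have hpow (n : ℕ) (b : B) (hb : b ∈ E ^ n) : φ u ^ n * ψ b ∈ φ.range := by
    induction n generalizing b with
    | zero =>
      rw [pow_zero, Submodule.mem_one] at hb
      obtain ⟨a, rfl⟩ := hb
      exact ⟨χ a, by rw [hχ, pow_zero, one_mul]⟩
    | succ n ih =>
      rw [pow_succ] at hb
      induction hb using Submodule.mul_induction_on' with
      | mem_mul_mem x hx y hy =>
        obtain ⟨a, ha⟩ := H y hy
        obtain ⟨c, hc⟩ := ih x hx
        refine ⟨c * a, ?_⟩
        rw [map_mul, map_mul, hc, ha, pow_succ]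
        linear_combination (φ u ^ n * ψ x * φ a) * hu
      | add x _ y _ hx hy =>
        rw [map_add, mul_add]
        exact φ.range.add_mem hx hy
  have hrange (p : rees E) : G p ∈ φ.range := by
    change eval₂ ψ (φ u) (p : B[X]) ∈ _
    rw [eval₂_eq_sum, Polynomial.sum]
    refine φ.range.sum_mem fun n _ ↦ ?_
    rw [mul_comm]
    exact hpow n _ (p.2 n)
  -- Injectivity of `φ` identifies `A'` with its image, so `G` descends to a map into `A'`.
  let σ : A' ≃+* φ.range := RingEquiv.ofBijective φ.rangeRestrict
    ⟨fun x y h ↦ hφ (congr_arg Subtype.val h), φ.rangeRestrict_surjective⟩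
  let F : rees E →+* A' := σ.symm.toRingHom.comp (G.codRestrict φ.range hrange)
  have hF (p : rees E) : φ (F p) = G p :=
    congr_arg Subtype.val (σ.apply_symm_apply ⟨G p, hrange p⟩)
  refine ⟨F, u, fun n p hp ↦ (hF p).trans (hG n p hp), hφ ?_, fun a ↦ hφ ?_⟩
  · rw [hF, hG 1 _ (reesMonomial_mem E 1 e _), reesEval_reesMonomial, pow_one, map_one, ← hu]
  · have h0 : G (reesZero E a) = ψ (algebraMap A B a) := eval₂_C ψ (φ u)
    rw [hF, hχ, h0]

end

/-! ### Local existence of the factorization -/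

section UniversalProperty

open Scheme

attribute [local instance] algebraSections

variable {Y X Y' X' : Scheme.{u}} {f : Y ⟶ X} {f' : Y' ⟶ X'}

lemma app_appLE_of_comm (hY : Y' ⟶ Y) (hX : X' ⟶ X) (w : hY ≫ f = f' ≫ hX) {V : X.Opens}
    {W : X'.Opens} (hW : W ≤ hX ⁻¹ᵁ V) (hYW : f' ⁻¹ᵁ W ≤ hY ⁻¹ᵁ f ⁻¹ᵁ V) (a : Γ(X, V)) :
    f'.app W (hX.appLE V W hW a) = hY.appLE (f ⁻¹ᵁ V) (f' ⁻¹ᵁ W) hYW (f.app V a) := by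
  have h : hX.appLE V W hW ≫ f'.app W = f.app V ≫ hY.appLE (f ⁻¹ᵁ V) (f' ⁻¹ᵁ W) hYW := by
    rw [Hom.app_eq_appLE, Hom.app_eq_appLE, Hom.appLE_comp_appLE, Hom.appLE_comp_appLE]
    simp only [w]
  exact congr($h a)

variable [IsAffineHom f] (E : BlowUpModule f)

lemma BlowUpModule.toSpecΓ_specToProj_toBase (hX : X' ⟶ X) (V : X.AffineZariskiSite)
    {W : X'.Opens} (hW : W ≤ hX ⁻¹ᵁ V.1) (F : rees (E.sections V.1) →+* Γ(X', W))
    (hF : ∀ a, F (reesZero (E.sections V.1) a) = hX.appLE V.1 W hW a)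
    {t : rees (E.sections V.1)} (hFt : IsUnit (F t)) {d : ℕ}
    (ht : t ∈ reesGrading (E.sections V.1) d) (hd : 0 < d) :
    (W.toSpecΓ ≫ specToProj _ F t hFt ht hd ≫ E.ι V) ≫ E.toBase = W.ι ≫ hX := by
  have H := specToProj_projToSpec F t hFt ht hd (reesZero (E.sections V.1))
    (hX.appLE V.1 W hW).hom hF
  rw [Category.assoc, Category.assoc, E.ι_toBase, BlowUpModule.chartMap, Category.assoc,
    reassoc_of% H, V.2.isoSpec_inv_ι]
  refine (Scheme.Opens.toSpecΓ_SpecMap_appLE_assoc hX V.1 W hW _).trans ?_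
  rw [V.2.toSpecΓ_fromSpec, Hom.resLE_comp_ι]

lemma BlowUpModule.ι_comp_lift (hY : Y' ⟶ Y) (V : X.AffineZariskiSite) {W : Y'.Opens}
    (hW : W ≤ hY ⁻¹ᵁ f ⁻¹ᵁ V.1) :
    W.ι ≫ hY ≫ E.lift = W.toSpecΓ ≫ Spec.map (hY.appLE (f ⁻¹ᵁ V.1) W hW) ≫
      specToProj _ (reesEval (E.sections V.1)) (reesOne (E.sections V.1) (E.one_mem V.1))
        (by rw [reesEval_reesOne]; exact isUnit_one) (reesOne_mem _ _) one_pos ≫ E.ι V := by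
  refine Eq.trans ?_ (Scheme.Opens.toSpecΓ_SpecMap_appLE_assoc hY (f ⁻¹ᵁ V.1) W hW _).symm
  rw [← Hom.resLE_comp_ι_assoc hY hW, E.ι_lift, BlowUpModule.liftChart, Category.assoc]

/-- Near `x` the morphism is given by `b T ^ d ↦ u ^ d * ψ b`. Dominance of `f'` supplies the
injection `Γ(X', W) → Γ(Y', f' ⁻¹ᵁ W)` needed to divide by `e`. -/
lemma BlowUpModule.exists_local_lift [IsSchemeTheoreticallyDominant f'] [QuasiCompact f']
    (hY : Y' ⟶ Y) (hX : X' ⟶ X) (w : hY ≫ f = f' ≫ hX)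
    (hE : IsInvertibleModule (inverseImageModule E
      (Arrow.homMk (f := Arrow.mk f') (g := Arrow.mk f) hY hX w))) (x : X') :
    ∃ W : X'.Opens, x ∈ W ∧ ∃ k : W.toScheme ⟶ E.scheme, k ≫ E.toBase = W.ι ≫ hX ∧
      (f' ∣_ W) ≫ k = (f' ⁻¹ᵁ W).ι ≫ hY ≫ E.lift := by
  obtain ⟨V, W, hxW, hW, hYW, e, he, H⟩ := exists_local_generator_sections E hY hX w hE x
  obtain ⟨F, u, hFdeg, hFe, hFzero⟩ := exists_ringHom_of_generator (E.sections V.1)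
    (hY.appLE (f ⁻¹ᵁ V.1) (f' ⁻¹ᵁ W) hYW).hom (f'.app W).hom (f'.app_injective W)
    (hX.appLE V.1 W hW).hom (app_appLE_of_comm hY hX w hW hYW) e he (E.one_mem V.1) H
  refine ⟨W, hxW, _, E.toSpecΓ_specToProj_toBase hX V hW F hFzero (hFe ▸ isUnit_one)
    (reesMonomial_mem _ 1 e _) one_pos, ?_⟩
  rw [E.ι_comp_lift hY V hYW]
  refine (Scheme.Opens.toSpecΓ_naturality_assoc f' W _).symm.trans ?_
  congr 1
  rw [← Category.assoc, ← Category.assoc]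
  congr 1
  refine (specMap_specToProj _ (f'.app W).hom F _ _ _).trans
    (Eq.trans ?_ (specMap_specToProj _ (hY.appLE (f ⁻¹ᵁ V.1) (f' ⁻¹ᵁ W) hYW).hom
      (reesEval (E.sections V.1)) _ _ _).symm)
  -- On `Y'` the two ring homomorphisms differ in degree `n` by the `n`-th power of `f'.app W u`,
  -- and their denominators are `e T` and `1 T`.
  refine (specToProj_eq_of_twist (𝒜 := reesGrading (E.sections V.1)) _ _ (f'.app W u) ?_
    _ _ _ _ _ _).symm
  exact hFdeg

end UniversalProperty

end RelBlowUp

theorem mainTheorem5 {Y X Y' X' : Scheme.{u}} {f : Y ⟶ X} {f' : Y' ⟶ X'}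
    [RelBlowUp.IsPair f] [RelBlowUp.IsPair f'] (E : RelBlowUp.BlowUpModule f)
    (h : Arrow.mk f' ⟶ Arrow.mk f)
    (hE : RelBlowUp.IsInvertibleModule (RelBlowUp.inverseImageModule E h)) :
    RelBlowUp.IsPair E.lift ∧
      ∃! h' : Arrow.mk f' ⟶ Arrow.mk E.lift, h' ≫ E.relBlowUpHom = h := by
  refine ⟨E.isPair_lift, ?_⟩
  have : IsSchemeTheoreticallyDominant f' := RelBlowUp.IsPair.isSchemeTheoreticallyDominant
  obtain ⟨k, ⟨hk, hk'⟩, huniq⟩ := RelBlowUp.existsUnique_lift_of_local f' E.toBase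
    (h.left ≫ E.lift) h.right (E.exists_local_lift h.left h.right h.w hE)
  refine ⟨Arrow.homMk h.left k hk'.symm, ?_, fun h' hh' ↦ ?_⟩
  · exact Arrow.hom_ext _ _ (Category.comp_id _) hk
  -- The left component of `g_E` is the identity of `Y`, so that of `h'` is forced.
  · have hl : h'.left = h.left := by rw [← hh']; exact (Category.comp_id _).symm
    refine Arrow.hom_ext _ _ hl (huniq _ ⟨?_, ?_⟩)
    · rw [← hh']; rfl
    · rw [← hl]; exact h'.w.symm
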